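/- Let $D\ge 3$ and $n\ge 0$ be integers. For a Lorentzian metric $g_{ab}$ in dimension $D$, let $R_{abcd}$, $R_{ab}$, $R$ be its Riemann tensor, Ricci tensor and Ricci scalar, with the conventions $R_{abc}{}^{d}=-2\partial_{[a}\Gamma_{b]c}{}^{d}+2\Gamma_{c[a}{}^{e}\Gamma_{b]e}{}^{d}$, $R_{ab}=R_{adb}{}^{d}$, $R=R_b{}^b$ (where $\Gamma_{ab}{}^{c}$ are the Christoffel symbols), let $Z_{ab}=R_{ab}-\tfrac1D g_{ab}R$, and put $$\mathcal K_2=\frac{1}{D(D-1)}Z_{ab}Z^{ab},\qquad \mathcal K_3=-\frac{1}{D(D-1)(D-2)}Z_{ab}Z^{bc}Z_c{}^{a}.$$ A curvature invariant of order $n$ is a complete contraction of $n$ copies of $R_{abcd}$ with $2n$ inverse metrics $g^{ab}$ (no covariant derivatives of the curvature and no parity-breaking terms). The FLRW metrics are $$\mathrm ds^2_{a,F}=-F(t)\,\mathrm dt^2+\frac{a(t)^2}{1-kr^2}\,\mathrm dr^2+a(t)^2r^2\,\mathrm d\Omega^2_{D-2},$$ where $k\in\{-1,0,1\}$, $a$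 and $F$ are positive $C^2$ functions on an open set of values of $t$, $r>0$, $1-kr^2>0$, and $\mathrm d\Omega^2_{D-2}$ is the round metric of the unit sphere $S^{D-2}$ in arbitrary local coordinates. Let $\mathcal R_{(n)}$ be any real linear combination of curvature invariants of order $n$. Then there are an integer $p\ge 0$, real coefficients $\beta_1,\dots,\beta_p$ and non-negative integers $b_1^{(i)},b_2^{(i)},b_3^{(i)}$ with $b_1^{(i)}+2b_2^{(i)}+3b_3^{(i)}=n$, all depending only on $D$, $n$ and $\mathcal R_{(n)}$ (not on $k$, $a$, $F$ or the point), such that on every FLRW metric $$\mathcal R_{(n)}\big|_{\mathrm ds^2_{a,F}}=\sum_{i=1}^{p}\beta_i\,\Big(R^{b_1^{(i)}}\,\mathcal K_2^{b_2^{(i)}}\,\mathcal K_3^{b_3^{(i)}}\Big)\Big|_{\mathrm ds^2_{a,F}}.$$ Moreover, on every FLRW metric $\mathcal K_2=\Gamma^2$ and $\mathcal K_3=\Gamma^3$, where $$\Gamma=\frac{(D-2)\,(2kF^2+2F\dot a^2+a\dot a\dot F-2a\ddot aF)}{2a^2F^2D}.$$ -/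

import Mathlib

noncomputable section

namespace Curv

/-! ### Curvature of a metric in local coordinates indexed by `ι` -/

/-- The partial derivative `∂_i f` at `x`. -/
def pd {ι E : Type*} [Fintype ι] [DecidableEq ι] [NormedAddCommGroup E] [NormedSpace ℝ E]
    (i : ι) (f : (ι → ℝ) → E) (x : ι → ℝ) : E :=
  fderiv ℝ f x (Pi.single i 1)

variable {ι : Type*} [Fintype ι] [DecidableEq ι]

/-- The components `g^{ab}` of the inverse metric. -/
def invMetric (g : (ι → ℝ) → Matrix ι ι ℝ) (x : ι → ℝ) : Matrix ι ι ℝ := (g x)⁻¹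

/-- `christoffel g a b c x` is the Christoffel symbol `Γ_{ab}^c` of the metric `g` at `x`. -/
def christoffel (g : (ι → ℝ) → Matrix ι ι ℝ) (a b c : ι) (x : ι → ℝ) : ℝ :=
  (1 / 2) * ∑ d, invMetric g x c d *
    (pd a (fun y => g y b d) x + pd b (fun y => g y a d) x - pd d (fun y => g y a b) x)

/-- `riemann g a b c d x` is `R_{abc}^d = -2 ∂_{[a} Γ_{b]c}^d + 2 Γ_{c[a}^e Γ_{b]e}^d` at `x`. -/
def riemann (g : (ι → ℝ) → Matrix ι ι ℝ) (a b c d : ι) (x : ι → ℝ) : ℝ :=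
  -(pd a (christoffel g b c d) x - pd b (christoffel g a c d) x)
    + ∑ e, (christoffel g c a e x * christoffel g b e d x
        - christoffel g c b e x * christoffel g a e d x)

/-- The fully covariant Riemann tensor `R_{abcd} = R_{abc}^e g_{ed}`. -/
def riemannLow (g : (ι → ℝ) → Matrix ι ι ℝ) (a b c d : ι) (x : ι → ℝ) : ℝ :=
  ∑ e, riemann g a b c e x * g x e d

/-- The Ricci tensor `R_{ab} = R_{adb}^d`. -/
def ricci (g : (ι → ℝ) → Matrix ι ι ℝ) (a b : ι) (x : ι → ℝ) : ℝ :=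
  ∑ d, riemann g a d b d x

/-- The Ricci scalar `R = g^{ab} R_{ab}`. -/
def scalarCurv (g : (ι → ℝ) → Matrix ι ι ℝ) (x : ι → ℝ) : ℝ :=
  ∑ a, ∑ b, invMetric g x a b * ricci g a b x

/-- The traceless Ricci tensor `Z_{ab} = R_{ab} - (1/D) g_{ab} R`, `D` the dimension. -/
def tracelessRicci (g : (ι → ℝ) → Matrix ι ι ℝ) (a b : ι) (x : ι → ℝ) : ℝ :=
  ricci g a b x - (1 / (Fintype.card ι : ℝ)) * g x a b * scalarCurv g x

/-- `Z_a^b = Z_{ac} g^{cb}`. -/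
def tracelessRicciMixed (g : (ι → ℝ) → Matrix ι ι ℝ) (a b : ι) (x : ι → ℝ) : ℝ :=
  ∑ c, tracelessRicci g a c x * invMetric g x c b

/-- `Z^{ab} = g^{ac} Z_c^b`. -/
def tracelessRicciUp (g : (ι → ℝ) → Matrix ι ι ℝ) (a b : ι) (x : ι → ℝ) : ℝ :=
  ∑ c, invMetric g x a c * tracelessRicciMixed g c b x

/-- `K₂ = Z_{ab} Z^{ab} / (D (D - 1))`. -/
def K2 (g : (ι → ℝ) → Matrix ι ι ℝ) (x : ι → ℝ) : ℝ :=
  (1 / ((Fintype.card ι : ℝ) * ((Fintype.card ι : ℝ) - 1))) *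
    ∑ a, ∑ b, tracelessRicci g a b x * tracelessRicciUp g a b x

/-- `K₃ = - Z_{ab} Z^{bc} Z_c^a / (D (D - 1) (D - 2))`. -/
def K3 (g : (ι → ℝ) → Matrix ι ι ℝ) (x : ι → ℝ) : ℝ :=
  -(1 / ((Fintype.card ι : ℝ) * ((Fintype.card ι : ℝ) - 1) * ((Fintype.card ι : ℝ) - 2))) *
    ∑ a, ∑ b, ∑ c, tracelessRicci g a b x * tracelessRicciUp g b c x
      * tracelessRicciMixed g c a x

/-! ### Curvature invariants -/

/-- A way of contracting all the indices of a product of `n` Riemann tensors: the `4n` index slots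
(`(i, s)` is the slot `s` of the `i`-th factor) are grouped into `2n` pairs. -/
abbrev Pattern (n : ℕ) : Type := Fin n × Fin 4 ≃ Fin (2 * n) × Fin 2

/-- The complete contraction of `n` tensors `R_{abcd}` with `2n` inverse metrics `g^{ab}`, where
the `j`-th inverse metric is contracted with the two slots that form the `j`-th pair of `e`. -/
def contraction {n : ℕ} (e : Pattern n) (g : (ι → ℝ) → Matrix ι ι ℝ) (x : ι → ℝ) : ℝ :=
  ∑ v : Fin n × Fin 4 → ι,
    (∏ i, riemannLow g (v (i, 0)) (v (i, 1)) (v (i, 2)) (v (i, 3)) x) *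
      ∏ j, invMetric g x (v (e.symm (j, 0))) (v (e.symm (j, 1)))

/-- The linear combination with real coefficients `c` of the invariants of order `n` in the
curvature. -/
def curvInvariant {n : ℕ} (c : Pattern n → ℝ) (g : (ι → ℝ) → Matrix ι ι ℝ) (x : ι → ℝ) : ℝ :=
  ∑ e : Pattern n, c e * contraction e g x

/-! ### FLRW metrics -/

/-- `ψ`, on the open set `U`, is a smooth local parametrization (an immersion) of the unit sphere
`S^m` in `ℝ^(m+1)`, that is, a system of local coordinates on the sphere. -/
structure IsSphereParam {m : ℕ} (ψ : (Fin m → ℝ) → EuclideanSpace ℝ (Fin (m + 1)))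
    (U : Set (Fin m → ℝ)) : Prop where
  isOpen : IsOpen U
  smooth : ContDiffOn ℝ (⊤ : ℕ∞) ψ U
  norm_eq_one : ∀ y ∈ U, ‖ψ y‖ = 1
  immersion : ∀ y ∈ U, Function.Injective (fderiv ℝ ψ y)

/-- The components `⟨∂_i ψ, ∂_j ψ⟩` of the round metric `dΩ²` in the coordinates given by `ψ`. -/
def roundMetric {m : ℕ} (ψ : (Fin m → ℝ) → EuclideanSpace ℝ (Fin (m + 1))) (y : Fin m → ℝ) :
    Matrix (Fin m) (Fin m) ℝ :=
  Matrix.of fun i j => inner ℝ (pd i ψ y) (pd j ψ y)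

/-- The coordinate indices of a spacetime of dimension `m + 2`: `t`, `r`, and `m` coordinates on
the sphere `S^m`. -/
abbrev Idx (m : ℕ) : Type := Unit ⊕ Unit ⊕ Fin m

/-- The coordinate `t` of a point. -/
def tOf {m : ℕ} (x : Idx m → ℝ) : ℝ := x (Sum.inl ())

/-- The coordinate `r` of a point. -/
def rOf {m : ℕ} (x : Idx m → ℝ) : ℝ := x (Sum.inr (Sum.inl ()))

/-- The coordinates of a point on the sphere `S^m`. -/
def angOf {m : ℕ} (x : Idx m → ℝ) : Fin m → ℝ := fun i => x (Sum.inr (Sum.inr i))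

/-- The metric `-F(t) dt² + a(t)² / (1 - k r²) dr² + a(t)² r² dΩ_m²` in dimension `m + 2`. -/
def flrwMetric {m : ℕ} (k : ℝ) (a F : ℝ → ℝ)
    (ψ : (Fin m → ℝ) → EuclideanSpace ℝ (Fin (m + 1))) (x : Idx m → ℝ) :
    Matrix (Idx m) (Idx m) ℝ :=
  Matrix.of fun p q =>
    match p, q with
    | Sum.inl _, Sum.inl _ => -F (tOf x)
    | Sum.inr (Sum.inl _), Sum.inr (Sum.inl _) => a (tOf x) ^ 2 / (1 - k * rOf x ^ 2)
    | Sum.inr (Sum.inr i), Sum.inr (Sum.inr j) =>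
        a (tOf x) ^ 2 * rOf x ^ 2 * roundMetric ψ (angOf x) i j
    | _, _ => 0

/-- The function `Γ(t) = (D-2) (2 k F² + 2 F ȧ² + a ȧ Ḟ - 2 a ä F) / (2 a² F² D)`. -/
def flrwGamma (D : ℕ) (k : ℝ) (a F : ℝ → ℝ) (t : ℝ) : ℝ :=
  ((D : ℝ) - 2) * (2 * k * F t ^ 2 + 2 * F t * deriv a t ^ 2 + a t * deriv a t * deriv F t
      - 2 * a t * deriv (deriv a) t * F t) / (2 * a t ^ 2 * F t ^ 2 * (D : ℝ))

end Curv

end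

/-!
The curvature of an FLRW metric `g` is the Kulkarni–Nomizu product of `g` with a symmetric form `S`
(the Weyl tensor vanishes). In an orthonormal frame `S` is diagonal, with one eigenvalue for `∂_t`
and another one for all spatial directions. Hence `S = R / (2 D (D - 1)) g + Z / (D - 2)`, where the
traceless part `Z` has the eigenvalues of `Γ diag (1 - D, 1, …, 1)`; this gives `K₂ = Γ²` and
`K₃ = Γ³`, and it makes a contraction of order `n` equal to `∑ j, γ j R^(n - j) Γ^j` with universal
coefficients. Over the complex numbers the frame can be chosen Euclidean, and then permuting the
directions shows that the term linear in `Z` is a multiple of the trace of `Z`, so `γ 1 = 0`. Every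
`j ≠ 1` is of the form `2 b₂ + 3 b₃`.
-/

noncomputable section

namespace Curv

open Filter Matrix Topology

/-! ### Partial derivatives -/

section PartialDerivatives

variable {ι E : Type*} [Fintype ι] [DecidableEq ι] [NormedAddCommGroup E] {x : ι → ℝ}

section NormedSpace

variable [NormedSpace ℝ E] {f g : (ι → ℝ) → E}

theorem pd_congr (i : ι) (h : f =ᶠ[𝓝 x] g) : pd i f x = pd i g x := by
  simp only [pd, h.fderiv_eq]

theorem pd_pd_eq_fderiv_fderiv (hf : ContDiffAt ℝ 2 f x) (i j : ι) :
    pd i (pd j f) x = fderiv ℝ (fderiv ℝ f) x (Pi.single i 1) (Pi.single j 1) := by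
  have hf' : DifferentiableAt ℝ (fderiv ℝ f) x :=
    (hf.fderiv_right (m := 1) (by norm_num)).differentiableAt (by norm_num)
  have hpd : pd j f = fun y => fderiv ℝ f y (Pi.single j 1) := rfl
  rw [pd, hpd, fderiv_clm_apply hf' (differentiableAt_const _)]
  simp

theorem pd_comm (hf : ContDiffAt ℝ 2 f x) (i j : ι) : pd i (pd j f) x = pd j (pd i f) x := by
  rw [pd_pd_eq_fderiv_fderiv hf, pd_pd_eq_fderiv_fderiv hf, (hf.isSymmSndFDerivAt (by simp)).eq]

theorem contDiffAt_pd {n m : WithTop ℕ∞} (hf : ContDiffAt ℝ n f x) (hmn : m + 1 ≤ n) (i : ι) :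
    ContDiffAt ℝ m (pd i f) x :=
  (hf.fderiv_right hmn).clm_apply contDiffAt_const

theorem differentiableAt_pd (hf : ContDiffAt ℝ 2 f x) (i : ι) : DifferentiableAt ℝ (pd i f) x :=
  (contDiffAt_pd (m := 1) hf (by norm_num) i).differentiableAt (by norm_num)

end NormedSpace

theorem pd_inner [InnerProductSpace ℝ E] {f g : (ι → ℝ) → E} (i : ι)
    (hf : DifferentiableAt ℝ f x) (hg : DifferentiableAt ℝ g x) :
    pd i (fun y => inner ℝ (f y) (g y)) x =
      inner ℝ (pd i f x) (g x) + inner ℝ (f x) (pd i g x) := by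
  simp only [pd, fderiv_inner_apply ℝ hf hg]
  ring

theorem pd_const (i : ι) (v : E) [NormedSpace ℝ E] : pd i (fun _ => v) x = 0 := by
  simp [pd]

theorem pd_mul {f g : (ι → ℝ) → ℝ} (i : ι) (hf : DifferentiableAt ℝ f x)
    (hg : DifferentiableAt ℝ g x) :
    pd i (fun y => f y * g y) x = pd i f x * g x + f x * pd i g x := by
  simp only [pd, fderiv_fun_mul hf hg, _root_.add_apply,
    _root_.smul_apply, smul_eq_mul]
  ring

theorem pd_sum {α : Type*} [Fintype α] [NormedSpace ℝ E] {f : α → (ι → ℝ) → E} (i : ι)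
    (hf : ∀ a, DifferentiableAt ℝ (f a) x) :
    pd i (fun y => ∑ a, f a y) x = ∑ a, pd i (f a) x := by
  simp only [pd, fderiv_fun_sum fun a _ => hf a, _root_.sum_apply]

end PartialDerivatives

/-! ### Christoffel symbols of the first kind -/

section Christoffel

variable {ι : Type*} [Fintype ι] [DecidableEq ι]

/-- The Christoffel symbol of the first kind `Γ_{ab,d}`. -/
def christoffelLow (g : (ι → ℝ) → Matrix ι ι ℝ) (a b d : ι) (x : ι → ℝ) : ℝ :=
  (1 / 2) * (pd a (fun y => g y b d) x + pd b (fun y => g y a d) x - pd d (fun y => g y a b) x)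

/-- The contraction `Γ_{ab,p} g^{pq} Γ_{cd,q}` of two Christoffel symbols of the first kind. -/
def christoffelInner (g : (ι → ℝ) → Matrix ι ι ℝ) (a b c d : ι) (x : ι → ℝ) : ℝ :=
  (christoffelLow g a b · x) ⬝ᵥ (g x)⁻¹ *ᵥ (christoffelLow g c d · x)

variable {g : (ι → ℝ) → Matrix ι ι ℝ} {x : ι → ℝ}

theorem christoffel_eq_mulVec (g : (ι → ℝ) → Matrix ι ι ℝ) (a b c : ι) (x : ι → ℝ) :
    christoffel g a b c x = ((g x)⁻¹ *ᵥ (christoffelLow g a b · x)) c := by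
  simp only [christoffel, christoffelLow, mulVec, dotProduct, invMetric, Finset.mul_sum]
  exact Finset.sum_congr rfl fun _ _ => by ring

theorem christoffelLow_symm (hs : ∀ y, (g y).IsSymm) (a b d : ι) :
    christoffelLow g a b d = christoffelLow g b a d := by
  funext y
  simp only [christoffelLow, fun z => (hs z).apply a b]
  ring

theorem christoffel_symm (hs : ∀ y, (g y).IsSymm) (a b c : ι) :
    christoffel g a b c = christoffel g b a c := by
  funext y
  simp only [christoffel_eq_mulVec, christoffelLow_symm hs a b]

theorem christoffelInner_comm (hs : (g x).IsSymm) (a b c d : ι) :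
    christoffelInner g a b c d x = christoffelInner g c d a b x := by
  have hinv : ((g x)⁻¹)ᵀ = (g x)⁻¹ := by rw [transpose_nonsing_inv, hs]
  rw [christoffelInner, christoffelInner, dotProduct_mulVec, dotProduct_comm, ← mulVec_transpose,
    hinv]

theorem christoffelInner_eq_sum (a b c d : ι) :
    christoffelInner g a b c d x = ∑ p, christoffel g c d p x * christoffelLow g a b p x := by
  simp only [christoffelInner, christoffel_eq_mulVec, dotProduct, mul_comm]

theorem pd_metric (hs : ∀ y, (g y).IsSymm) (a b d : ι) :
    pd a (fun y => g y b d) x = christoffelLow g a b d x + christoffelLow g a d b x := by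
  simp only [christoffelLow, fun z => (hs z).apply b d]
  ring

theorem differentiableAt_det (hg : ∀ i j, DifferentiableAt ℝ (fun y => g y i j) x) :
    DifferentiableAt ℝ (fun y => (g y).det) x := by
  simp only [det_apply']
  fun_prop

theorem differentiableAt_invMetric (hg : ∀ i j, DifferentiableAt ℝ (fun y => g y i j) x)
    (hd : (g x).det ≠ 0) (i j : ι) : DifferentiableAt ℝ (fun y => invMetric g y i j) x := by
  simp only [invMetric, inv_def, Matrix.smul_apply, Ring.inverse_eq_inv', smul_eq_mul,
    adjugate_apply]
  refine ((differentiableAt_det hg).inv hd).mul (differentiableAt_det fun k l => ?_)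
  obtain rfl | hk := eq_or_ne k j
  · simp
  · simpa [updateRow_ne hk] using hg k l

theorem differentiableAt_christoffelLow (hg : ∀ i j, ContDiffAt ℝ 2 (fun y => g y i j) x)
    (a b d : ι) : DifferentiableAt ℝ (christoffelLow g a b d) x :=
  (((differentiableAt_pd (hg b d) a).add (differentiableAt_pd (hg a d) b)).sub
    (differentiableAt_pd (hg a b) d)).const_mul _

theorem differentiableAt_christoffel (hg : ∀ i j, ContDiffAt ℝ 2 (fun y => g y i j) x)
    (hd : (g x).det ≠ 0) (a b c : ι) : DifferentiableAt ℝ (christoffel g a b c) x := by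
  have hΓ : christoffel g a b c = fun y => ∑ d, invMetric g y c d * christoffelLow g a b d y :=
    funext (christoffel_eq_mulVec g a b c)
  have hinv := differentiableAt_invMetric (fun i j => (hg i j).differentiableAt (by norm_num)) hd
  rw [hΓ]
  exact DifferentiableAt.fun_sum fun d _ =>
    (hinv c d).mul (differentiableAt_christoffelLow hg a b d)

theorem sum_christoffel_mul_metric (hs : (g x).IsSymm) (hd : (g x).det ≠ 0) (a b c : ι) :
    ∑ d, christoffel g a b d x * g x d c = christoffelLow g a b c x := by
  have hmul : g x *ᵥ (christoffel g a b · x) = (christoffelLow g a b · x) := by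
    simp only [christoffel_eq_mulVec, mulVec_mulVec,
      mul_nonsing_inv _ (isUnit_iff_ne_zero.2 hd), one_mulVec]
  rw [← congrFun hmul c]
  exact Finset.sum_congr rfl fun d _ => by rw [mul_comm, hs.apply]

theorem sum_pd_christoffel_mul_metric (hs : ∀ y, (g y).IsSymm)
    (hg : ∀ i j, ContDiffAt ℝ 2 (fun y => g y i j) x) (hd : (g x).det ≠ 0) (a b c f : ι) :
    ∑ d, pd a (christoffel g b c d) x * g x d f = pd a (christoffelLow g b c f) x
      - ∑ d, christoffel g b c d x * (christoffelLow g a d f x + christoffelLow g a f d x) := by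
  have hg₁ : ∀ i j, DifferentiableAt ℝ (fun y => g y i j) x :=
    fun i j => (hg i j).differentiableAt (by norm_num)
  have hΓ := differentiableAt_christoffel hg hd
  have hlow : christoffelLow g b c f =ᶠ[𝓝 x] fun y => ∑ d, christoffel g b c d y * g y d f := by
    filter_upwards [(differentiableAt_det hg₁).continuousAt.eventually_ne hd] with y hy
    exact (sum_christoffel_mul_metric (hs y) hy b c f).symm
  rw [pd_congr a hlow, pd_sum a fun d => (hΓ b c d).fun_mul (hg₁ d f), ← Finset.sum_sub_distrib]
  refine Finset.sum_congr rfl fun d _ => ?_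
  rw [pd_mul a (hΓ b c d) (hg₁ d f), pd_metric hs]
  ring

theorem sum_christoffel_mul_christoffel_mul_metric (hs : ∀ y, (g y).IsSymm) (hd : (g x).det ≠ 0)
    (a b c f : ι) :
    ∑ d, (∑ e, (christoffel g c a e x * christoffel g b e d x
        - christoffel g c b e x * christoffel g a e d x)) * g x d f
      = ∑ e, (christoffel g a c e x * christoffelLow g b e f x
        - christoffel g b c e x * christoffelLow g a e f x) := by
  simp only [← sum_christoffel_mul_metric (hs x) hd, Finset.sum_mul, Finset.mul_sum,
    ← Finset.sum_sub_distrib, christoffel_symm hs c]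
  rw [Finset.sum_comm]
  exact Finset.sum_congr rfl fun _ _ => Finset.sum_congr rfl fun _ _ => by ring

theorem riemannLow_eq_christoffelLow (hs : ∀ y, (g y).IsSymm)
    (hg : ∀ i j, ContDiffAt ℝ 2 (fun y => g y i j) x) (hd : (g x).det ≠ 0) (a b c f : ι) :
    riemannLow g a b c f x = -pd a (christoffelLow g b c f) x + pd b (christoffelLow g a c f) x
      + christoffelInner g a f b c x - christoffelInner g b f a c x := by
  have hR : riemannLow g a b c f x = -(∑ d, pd a (christoffel g b c d) x * g x d f)
      + (∑ d, pd b (christoffel g a c d) x * g x d f)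
      + ∑ d, (∑ e, (christoffel g c a e x * christoffel g b e d x
        - christoffel g c b e x * christoffel g a e d x)) * g x d f := by
    rw [riemannLow, ← Finset.sum_neg_distrib, ← Finset.sum_add_distrib, ← Finset.sum_add_distrib]
    exact Finset.sum_congr rfl fun _ _ => by rw [riemann]; ring
  rw [hR, sum_christoffel_mul_christoffel_mul_metric hs hd, sum_pd_christoffel_mul_metric hs hg hd,
    sum_pd_christoffel_mul_metric hs hg hd, christoffelInner_eq_sum, christoffelInner_eq_sum]
  simp only [mul_add, Finset.sum_add_distrib, Finset.sum_sub_distrib]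
  ring

theorem riemannLow_swap_left (g : (ι → ℝ) → Matrix ι ι ℝ) (x : ι → ℝ) (a b c d : ι) :
    riemannLow g b a c d x = -riemannLow g a b c d x := by
  simp only [riemannLow, riemann, ← Finset.sum_neg_distrib, Finset.sum_sub_distrib]
  exact Finset.sum_congr rfl fun _ _ => by ring

theorem pd_christoffelLow_add_swap (hs : ∀ y, (g y).IsSymm)
    (hg : ∀ i j, ContDiffAt ℝ 2 (fun y => g y i j) x) (a b c d : ι) :
    pd a (christoffelLow g b c d) x + pd a (christoffelLow g b d c) x
      = pd a (pd b fun y => g y c d) x := by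
  have hmetric : (pd b fun y => g y c d) =
      fun y => christoffelLow g b c d y + christoffelLow g b d c y :=
    funext fun y => pd_metric hs b c d
  have hΓ := differentiableAt_christoffelLow hg
  simp only [hmetric, pd, fderiv_fun_add (hΓ b c d) (hΓ b d c), _root_.add_apply]

theorem riemannLow_swap_right (hs : ∀ y, (g y).IsSymm)
    (hg : ∀ i j, ContDiffAt ℝ 2 (fun y => g y i j) x) (hd : (g x).det ≠ 0) (a b c d : ι) :
    riemannLow g a b d c x = -riemannLow g a b c d x := by
  have hab := pd_christoffelLow_add_swap hs hg a b c d
  have hba := pd_christoffelLow_add_swap hs hg b a c d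
  rw [pd_comm (hg c d) b a] at hba
  rw [riemannLow_eq_christoffelLow hs hg hd, riemannLow_eq_christoffelLow hs hg hd,
    christoffelInner_comm (hs x) a c, christoffelInner_comm (hs x) b c]
  linarith

end Christoffel

/-! ### The Gauss equation and the curvature of the round sphere -/

section Immersion

variable {ι E : Type*} [Fintype ι] [DecidableEq ι] [NormedAddCommGroup E] [InnerProductSpace ℝ E]
  {ψ : (ι → ℝ) → E} {y : ι → ℝ}

theorem inner_starProjection_span_eq_gram {e : ι → E}
    [hP : (Submodule.span ℝ (Set.range e)).HasOrthogonalProjection] (he : LinearIndependent ℝ e)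
    (v w : E) :
    inner ℝ v ((Submodule.span ℝ (Set.range e)).starProjection w) =
      (inner ℝ v <| e ·) ⬝ᵥ (gram ℝ e)⁻¹ *ᵥ (inner ℝ w <| e ·) := by
  set c : ι → ℝ := (gram ℝ e)⁻¹ *ᵥ (inner ℝ w <| e ·) with hc
  have hgram : gram ℝ e *ᵥ c = (inner ℝ w <| e ·) := by
    rw [hc, mulVec_mulVec, mul_nonsing_inv _ (isUnit_iff_ne_zero.2
      (det_gram_ne_zero_iff_linearIndependent.2 he)), one_mulVec]
  have hproj : (Submodule.span ℝ (Set.range e)).starProjection w = ∑ i, c i • e i := by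
    refine Submodule.eq_starProjection_of_mem_orthogonal (Submodule.sum_mem _ fun i _ =>
      Submodule.smul_mem _ _ (Submodule.subset_span (Set.mem_range_self i))) ?_
    rw [Submodule.mem_orthogonal]
    refine fun u hu => Submodule.span_induction ?_ (by simp) (fun _ _ _ _ h₁ h₂ => ?_)
      (fun r _ _ h => ?_) hu
    · rintro _ ⟨j, rfl⟩
      simp only [inner_sub_right, inner_sum, inner_smul_right, real_inner_comm w (e j),
        ← congrFun hgram j, mulVec, dotProduct, gram_apply, mul_comm (c _), sub_self]
    · rw [inner_add_left, h₁, h₂, add_zero]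
    · rw [inner_smul_left, h, mul_zero]
  simp only [hproj, inner_sum, inner_smul_right, dotProduct, mul_comm]

/-- The metric induced on the parameter domain by a map into a Euclidean space, with components
`⟨∂_i ψ, ∂_j ψ⟩`. -/
def inducedMetric (ψ : (ι → ℝ) → E) (y : ι → ℝ) : Matrix ι ι ℝ := gram ℝ fun i => pd i ψ y

/-- The tangent space of a parametrized submanifold, as a subspace of the ambient space. -/
def tangentSpan (ψ : (ι → ℝ) → E) (y : ι → ℝ) : Submodule ℝ E :=
  Submodule.span ℝ (Set.range fun i => pd i ψ y)

instance : FiniteDimensional ℝ (tangentSpan ψ y) :=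
  FiniteDimensional.span_of_finite ℝ (Set.finite_range _)

/-- The second fundamental form of a parametrized submanifold: the component of `∂_a ∂_b ψ` normal
to it. -/
def secondFundamentalForm (ψ : (ι → ℝ) → E) (a b : ι) (y : ι → ℝ) : E :=
  (tangentSpan ψ y)ᗮ.starProjection (pd a (pd b ψ) y)

theorem inducedMetric_isSymm (ψ : (ι → ℝ) → E) (y : ι → ℝ) : (inducedMetric ψ y).IsSymm :=
  Matrix.ext fun _ _ => real_inner_comm _ _

theorem contDiffAt_inducedMetric (hψ : ContDiffAt ℝ 3 ψ y) (i j : ι) :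
    ContDiffAt ℝ 2 (fun z => inducedMetric ψ z i j) y :=
  (contDiffAt_pd hψ (by norm_num) i).inner ℝ (contDiffAt_pd hψ (by norm_num) j)

theorem christoffelLow_inducedMetric (hψ : ContDiffAt ℝ 2 ψ y) (i j k : ι) :
    christoffelLow (inducedMetric ψ) i j k y = inner ℝ (pd i (pd j ψ) y) (pd k ψ y) := by
  have hd := differentiableAt_pd hψ
  simp only [christoffelLow, inducedMetric, gram_apply, pd_inner _ (hd _) (hd _), pd_comm hψ j i,
    pd_comm hψ k i, pd_comm hψ k j, real_inner_comm _ (pd j ψ y)]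
  ring

theorem pd_christoffelLow_inducedMetric (hψ : ContDiffAt ℝ 3 ψ y) (a b c d : ι) :
    pd a (christoffelLow (inducedMetric ψ) b c d) y = inner ℝ (pd a (pd b (pd c ψ)) y) (pd d ψ y)
      + inner ℝ (pd b (pd c ψ) y) (pd a (pd d ψ) y) := by
  have hc : ∀ c, ContDiffAt ℝ 2 (pd c ψ) y := contDiffAt_pd hψ (by norm_num)
  rw [← pd_inner a (differentiableAt_pd (hc c) b) ((hc d).differentiableAt (by norm_num))]
  refine pd_congr a ?_
  filter_upwards [(hψ.of_le (m := 2) (by norm_num)).eventually (by norm_num)] with z hz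
  exact christoffelLow_inducedMetric hz b c d

theorem christoffelInner_inducedMetric (hψ : ContDiffAt ℝ 2 ψ y)
    (hi : LinearIndependent ℝ fun i => pd i ψ y) (a b c d : ι) :
    christoffelInner (inducedMetric ψ) a b c d y =
      inner ℝ (pd a (pd b ψ) y) (pd c (pd d ψ) y)
        - inner ℝ (secondFundamentalForm ψ a b y) (secondFundamentalForm ψ c d y) := by
  have htangent : christoffelInner (inducedMetric ψ) a b c d y =
      inner ℝ (pd a (pd b ψ) y) ((tangentSpan ψ y).starProjection (pd c (pd d ψ) y)) := by
    simp only [christoffelInner, christoffelLow_inducedMetric hψ]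
    exact (inner_starProjection_span_eq_gram
      (hP := inferInstanceAs (tangentSpan ψ y).HasOrthogonalProjection) hi _ _).symm
  rw [htangent, secondFundamentalForm, secondFundamentalForm,
    Submodule.inner_starProjection_left_eq_right,
    Submodule.starProjection_eq_self_iff.2 (Submodule.starProjection_apply_mem _ _),
    Submodule.starProjection_orthogonal_val, inner_sub_right, sub_sub_cancel]

theorem riemannLow_inducedMetric (hψ : ContDiffAt ℝ 3 ψ y)
    (hi : LinearIndependent ℝ fun i => pd i ψ y) (a b c d : ι) :
    riemannLow (inducedMetric ψ) a b c d y =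
      inner ℝ (secondFundamentalForm ψ a c y) (secondFundamentalForm ψ b d y)
        - inner ℝ (secondFundamentalForm ψ b c y) (secondFundamentalForm ψ a d y) := by
  have hψ₂ : ContDiffAt ℝ 2 ψ y := hψ.of_le (by norm_num)
  rw [riemannLow_eq_christoffelLow (inducedMetric_isSymm ψ) (contDiffAt_inducedMetric hψ)
      (det_gram_ne_zero_iff_linearIndependent.2 hi),
    pd_christoffelLow_inducedMetric hψ, pd_christoffelLow_inducedMetric hψ,
    christoffelInner_inducedMetric hψ₂ hi, christoffelInner_inducedMetric hψ₂ hi,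
    pd_comm (contDiffAt_pd hψ (by norm_num) c) a b, real_inner_comm (pd b (pd c ψ) y),
    real_inner_comm (pd a (pd c ψ) y), real_inner_comm (secondFundamentalForm ψ a d y),
    real_inner_comm (secondFundamentalForm ψ b d y)]
  ring

end Immersion

section Sphere

variable {m : ℕ} {ψ : (Fin m → ℝ) → EuclideanSpace ℝ (Fin (m + 1))} {U : Set (Fin m → ℝ)}
  {y : Fin m → ℝ}

theorem roundMetric_eq_inducedMetric : roundMetric ψ = inducedMetric ψ := rfl

theorem IsSphereParam.contDiffAt (h : IsSphereParam ψ U) (hy : y ∈ U) (n : ℕ) :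
    ContDiffAt ℝ n ψ y :=
  contDiffAt_infty.1 (h.smooth.contDiffAt (h.isOpen.mem_nhds hy)) n

theorem IsSphereParam.linearIndependent (h : IsSphereParam ψ U) (hy : y ∈ U) :
    LinearIndependent ℝ fun i => pd i ψ y := by
  have hpd : (fun i => pd i ψ y) = (fderiv ℝ ψ y).toLinearMap ∘ Pi.basisFun ℝ (Fin m) := by
    funext i
    simp [pd]
  rw [hpd]
  exact (Pi.basisFun ℝ (Fin m)).linearIndependent.map' _
    (LinearMap.ker_eq_bot.2 (h.immersion y hy))

theorem IsSphereParam.posDef_roundMetric (h : IsSphereParam ψ U) (hy : y ∈ U) :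
    (roundMetric ψ y).PosDef :=
  posDef_gram_of_linearIndependent (h.linearIndependent hy)

theorem IsSphereParam.inner_pd_self (h : IsSphereParam ψ U) (hy : y ∈ U) (i : Fin m) :
    inner ℝ (pd i ψ y) (ψ y) = (0 : ℝ) := by
  have hd : DifferentiableAt ℝ ψ y := (h.contDiffAt hy 1).differentiableAt (by simp)
  have hone : (fun z => (inner ℝ (ψ z) (ψ z) : ℝ)) =ᶠ[𝓝 y] fun _ => 1 := by
    filter_upwards [h.isOpen.mem_nhds hy] with z hz
    rw [real_inner_self_eq_norm_sq, h.norm_eq_one z hz, one_pow]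
  have hpd := pd_congr i hone
  rw [pd_inner i hd hd, pd_const, real_inner_comm (pd i ψ y)] at hpd
  linarith

theorem IsSphereParam.inner_pd_pd_self (h : IsSphereParam ψ U) (hy : y ∈ U) (i j : Fin m) :
    inner ℝ (pd i (pd j ψ) y) (ψ y) = -roundMetric ψ y i j := by
  have hψ := h.contDiffAt hy 2
  have hzero : (fun z => (inner ℝ (pd j ψ z) (ψ z) : ℝ)) =ᶠ[𝓝 y] fun _ => 0 := by
    filter_upwards [h.isOpen.mem_nhds hy] with z hz
    exact h.inner_pd_self hz j
  have hpd := pd_congr i hzero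
  rw [pd_inner i (differentiableAt_pd hψ j) (hψ.differentiableAt (by simp)), pd_const,
    real_inner_comm (pd i ψ y)] at hpd
  exact eq_neg_of_add_eq_zero_left hpd

theorem IsSphereParam.tangentSpan_eq (h : IsSphereParam ψ U) (hy : y ∈ U) :
    tangentSpan ψ y = (ℝ ∙ ψ y)ᗮ := by
  have hfinrank : Fact (Module.finrank ℝ (EuclideanSpace ℝ (Fin (m + 1))) = m + 1) := ⟨by simp⟩
  have hne : ψ y ≠ 0 := norm_ne_zero_iff.1 (by rw [h.norm_eq_one y hy]; exact one_ne_zero)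
  refine Submodule.eq_of_le_of_finrank_eq (Submodule.span_le.2 ?_) ?_
  · rintro _ ⟨i, rfl⟩
    exact Submodule.mem_orthogonal_singleton_iff_inner_left.2 (h.inner_pd_self hy i)
  · rw [Submodule.finrank_orthogonal_span_singleton (n := m) hne, tangentSpan,
      finrank_span_eq_card (h.linearIndependent hy), Fintype.card_fin]

theorem IsSphereParam.secondFundamentalForm_eq (h : IsSphereParam ψ U) (hy : y ∈ U)
    (a b : Fin m) : secondFundamentalForm ψ a b y = -roundMetric ψ y a b • ψ y := by
  have hnormal : (tangentSpan ψ y)ᗮ = ℝ ∙ ψ y := by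
    rw [h.tangentSpan_eq hy, Submodule.orthogonal_orthogonal]
  simp only [secondFundamentalForm, hnormal]
  rw [Submodule.starProjection_unit_singleton ℝ (h.norm_eq_one y hy),
    real_inner_comm, h.inner_pd_pd_self hy]

theorem IsSphereParam.riemannLow_roundMetric (h : IsSphereParam ψ U) (hy : y ∈ U)
    (a b c d : Fin m) :
    riemannLow (roundMetric ψ) a b c d y = roundMetric ψ y a c * roundMetric ψ y b d
      - roundMetric ψ y a d * roundMetric ψ y b c := by
  have hself : inner ℝ (ψ y) (ψ y) = (1 : ℝ) := by
    rw [real_inner_self_eq_norm_sq, h.norm_eq_one y hy, one_pow]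
  simp only [roundMetric_eq_inducedMetric, riemannLow_inducedMetric (h.contDiffAt hy 3)
      (h.linearIndependent hy), h.secondFundamentalForm_eq hy,
    inner_smul_left, inner_smul_right, hself]
  simp only [conj_trivial]
  ring

end Sphere

/-! ### Complete contractions of Kulkarni–Nomizu products -/

section Contraction

variable {ι R : Type*} [CommRing R]

/-- The Kulkarni–Nomizu product `A ∧ B` of two symmetric tensors of rank two. -/
def kulkarniNomizu : Matrix ι ι R →ₗ[R] Matrix ι ι R →ₗ[R] ((Fin 4 → ι) → R) :=
  LinearMap.mk₂ R
    (fun A B u => A (u 0) (u 2) * B (u 1) (u 3) + A (u 1) (u 3) * B (u 0) (u 2)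
      - A (u 0) (u 3) * B (u 1) (u 2) - A (u 1) (u 2) * B (u 0) (u 3))
    (fun _ _ _ => funext fun _ => by simp only [Matrix.add_apply, Pi.add_apply]; ring)
    (fun _ _ _ => funext fun _ => by
      simp only [Matrix.smul_apply, Pi.smul_apply, smul_eq_mul]; ring)
    (fun _ _ _ => funext fun _ => by simp only [Matrix.add_apply, Pi.add_apply]; ring)
    (fun _ _ _ => funext fun _ => by
      simp only [Matrix.smul_apply, Pi.smul_apply, smul_eq_mul]; ring)

theorem kulkarniNomizu_apply (A B : Matrix ι ι R) (u : Fin 4 → ι) :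
    kulkarniNomizu A B u = A (u 0) (u 2) * B (u 1) (u 3) + A (u 1) (u 3) * B (u 0) (u 2)
      - A (u 0) (u 3) * B (u 1) (u 2) - A (u 1) (u 2) * B (u 0) (u 3) := rfl

variable [Fintype ι] {n : ℕ}

theorem sum_prod_mul_prod_pairs {σ J : Type*} [Fintype σ] [DecidableEq σ] [Fintype J]
    (e : σ ≃ J × Fin 2) (E : Matrix ι ι R) (G : J → Matrix ι ι R) (w : σ → ι) :
    ∑ v : σ → ι, (∏ p, E (v p) (w p)) * ∏ j, G j (v (e.symm (j, 0))) (v (e.symm (j, 1)))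
      = ∏ j, (Eᵀ * G j * E) (w (e.symm (j, 0))) (w (e.symm (j, 1))) := by
  classical
  have hE : ∀ j a b, (Eᵀ * G j * E) a b
      = ∑ u : Fin 2 → ι, E (u 0) a * E (u 1) b * G j (u 0) (u 1) := fun j a b => by
    rw [← (finTwoArrowEquiv ι).symm.sum_comp, Fintype.sum_prod_type_right]
    simp only [mul_apply, transpose_apply, Finset.sum_mul]
    exact Finset.sum_congr rfl fun _ _ => Finset.sum_congr rfl fun _ _ => by
      rw [mul_right_comm]; rfl
  simp only [hE, Finset.prod_univ_sum, Fintype.piFinset_univ]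
  rw [← (Equiv.curry J (Fin 2) ι).sum_comp, ← (Equiv.arrowCongr e (Equiv.refl ι)).symm.sum_comp]
  refine Finset.sum_congr rfl fun u _ => ?_
  rw [← e.symm.prod_comp, Fintype.prod_prod_type, ← Finset.prod_mul_distrib]
  refine Finset.prod_congr rfl fun j _ => ?_
  simp [Fin.prod_univ_two, Equiv.arrowCongr]

/-- The covariant tensor of rank four whose components in the frame `E` (in which the index of the
frame is the second one) are `T`. -/
def changeFrame (E : Matrix ι ι R) (T : (Fin 4 → ι) → R) (u : Fin 4 → ι) : R :=
  ∑ w : Fin 4 → ι, (∏ s, E (u s) (w s)) * T w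

theorem changeFrame_mul_pairs (E A B : Matrix ι ι R) (u : Fin 4 → ι) :
    changeFrame E (fun w => A (w 0) (w 2) * B (w 1) (w 3)) u
      = (E * A * Eᵀ) (u 0) (u 2) * (E * B * Eᵀ) (u 1) (u 3) := by
  have hpairs := sum_prod_mul_prod_pairs
    (finProdFinEquiv.symm.trans (Equiv.prodComm (Fin 2) (Fin 2))) Eᵀ ![A, B] u
  simp only [Fin.prod_univ_two, transpose_transpose, transpose_apply] at hpairs
  exact hpairs

theorem changeFrame_comp_perm (E : Matrix ι ι R) (T : (Fin 4 → ι) → R) (τ : Equiv.Perm (Fin 4))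
    (u : Fin 4 → ι) : changeFrame E (fun w => T (w ∘ τ)) u = changeFrame E T (u ∘ τ) := by
  rw [changeFrame, ← (Equiv.arrowCongr τ (Equiv.refl ι)).sum_comp]
  refine Finset.sum_congr rfl fun w _ => ?_
  rw [← Equiv.prod_comp τ]
  simp [Equiv.arrowCongr, Function.comp_assoc]

theorem changeFrame_kulkarniNomizu (E A B : Matrix ι ι R) :
    changeFrame E (kulkarniNomizu A B) = kulkarniNomizu (E * A * Eᵀ) (E * B * Eᵀ) := by
  have hswap : ∀ (A B : Matrix ι ι R) u, changeFrame E (fun w => A (w 0) (w 3) * B (w 1) (w 2)) u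
      = (E * A * Eᵀ) (u 0) (u 3) * (E * B * Eᵀ) (u 1) (u 2) := fun A B u => by
    have := changeFrame_comp_perm E (fun w => A (w 0) (w 2) * B (w 1) (w 3)) (Equiv.swap 2 3) u
    rw [changeFrame_mul_pairs] at this
    simpa [Equiv.swap_apply_of_ne_of_ne] using this
  funext u
  rw [kulkarniNomizu_apply, mul_comm ((E * A * Eᵀ) (u 1) (u 3)),
    mul_comm ((E * A * Eᵀ) (u 1) (u 2)), ← changeFrame_mul_pairs, ← changeFrame_mul_pairs,
    ← hswap, ← hswap]
  simp only [changeFrame, ← Finset.sum_add_distrib, ← Finset.sum_sub_distrib]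
  exact Finset.sum_congr rfl fun w _ => by rw [kulkarniNomizu_apply]; ring

/-- The complete contraction of `n` covariant tensors of rank four, along the pattern `e`, with
`2 n` copies of the contravariant tensor `G` of rank two. -/
def fullContraction (e : Pattern n) (G : Matrix ι ι R) :
    MultilinearMap R (fun _ : Fin n => (Fin 4 → ι) → R) R :=
  ∑ v : Fin n × Fin 4 → ι, (∏ j, G (v (e.symm (j, 0))) (v (e.symm (j, 1)))) •
    (MultilinearMap.mkPiAlgebra R (Fin n) R).compLinearMap
      fun i => LinearMap.proj fun s => v (i, s)

theorem fullContraction_apply (e : Pattern n) (G : Matrix ι ι R)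
    (T : Fin n → (Fin 4 → ι) → R) :
    fullContraction e G T = ∑ v : Fin n × Fin 4 → ι, (∏ i, T i fun s => v (i, s)) *
      ∏ j, G (v (e.symm (j, 0))) (v (e.symm (j, 1))) := by
  simp [fullContraction, mul_comm]

theorem map_fullContraction {R' : Type*} [CommRing R'] (f : R →+* R') (e : Pattern n)
    (G : Matrix ι ι R) (T : Fin n → (Fin 4 → ι) → R) :
    f (fullContraction e G T) = fullContraction e (G.map f) fun i => f ∘ T i := by
  simp [fullContraction_apply]

theorem fullContraction_changeFrame (e : Pattern n) (E G : Matrix ι ι R)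
    (T : Fin n → (Fin 4 → ι) → R) :
    fullContraction e G (fun i => changeFrame E (T i)) = fullContraction e (Eᵀ * G * E) T := by
  classical
  simp only [fullContraction_apply, ← sum_prod_mul_prod_pairs, changeFrame, Finset.prod_univ_sum,
    Fintype.piFinset_univ, Finset.mul_sum, Finset.sum_mul]
  rw [Finset.sum_comm, ← (Equiv.curry (Fin n) (Fin 4) ι).sum_comp]
  refine Finset.sum_congr rfl fun w _ => Finset.sum_congr rfl fun v _ => ?_
  simp only [Finset.prod_mul_distrib, Fintype.prod_prod_type, Equiv.curry_apply,
    Function.curry_apply]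
  rw [mul_left_comm, mul_assoc]
  rfl

end Contraction

/-! ### Contractions of diagonal tensors -/

section DiagContraction

variable {ι R : Type*} [Fintype ι] [CommRing R] {n : ℕ}

theorem linearMap_eq_zero_of_perm_invariant {M : Type*} [AddCommGroup M]
    [Module R M] {L : (ι → R) →ₗ[R] M} (hL : ∀ (σ : Equiv.Perm ι) z, L (z ∘ σ) = L z) {z : ι → R}
    (hz : ∑ a, z a = 0) : L z = 0 := by
  classical
  obtain _ | ⟨⟨b⟩⟩ := isEmpty_or_nonempty ι
  · rw [Subsingleton.elim z 0, map_zero]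
  have hsingle : ∀ a, L (Pi.single a 1) = L (Pi.single b 1) := fun a => by
    rw [← hL (Equiv.swap a b), Pi.single_comp_equiv, Equiv.symm_swap, Equiv.swap_apply_left]
  calc L z = ∑ a, z a • L (Pi.single a 1) := by
        conv_lhs => rw [← Finset.univ_sum_single z, map_sum]
        exact Finset.sum_congr rfl fun a _ => by rw [← map_smul, ← Pi.single_smul, smul_eq_mul,
          mul_one]
    _ = 0 := by simp only [hsingle, ← Finset.sum_smul, hz, zero_smul]

theorem multilinearMap_smul_add_smul {M N : Type*} [AddCommGroup M] [Module R M] [AddCommGroup N]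
    [Module R N] (f : MultilinearMap R (fun _ : Fin n => M) N) (X Y : R) (A B : M) :
    f (fun _ => X • A + Y • B) = ∑ j ∈ Finset.range (n + 1), (X ^ (n - j) * Y ^ j) •
      ∑ S ∈ Finset.powersetCard j Finset.univ, f (S.piecewise (fun _ => B) fun _ => A) := by
  have hcoeff : ∀ S : Finset (Fin n), f (S.piecewise (fun _ => Y • B) fun _ => X • A)
      = (X ^ (n - S.card) * Y ^ S.card) • f (S.piecewise (fun _ => B) fun _ => A) := fun S => by
    have hsmul : S.piecewise (fun _ => Y • B) (fun _ => X • A) = fun i =>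
        S.piecewise (fun _ => Y) (fun _ => X) i • S.piecewise (fun _ => B) (fun _ => A) i := by
      funext i
      by_cases hi : i ∈ S <;> simp [hi]
    rw [hsmul, f.map_smul_univ, Finset.prod_piecewise]
    simp [Finset.card_sdiff, mul_comm]
  have hadd : (fun _ : Fin n => X • A + Y • B) = (fun _ => Y • B) + fun _ => X • A :=
    funext fun _ => add_comm _ _
  rw [hadd, f.map_add_univ, ← Finset.powerset_univ, Finset.sum_powerset, Finset.card_univ,
    Fintype.card_fin]
  refine Finset.sum_congr rfl fun j _ => ?_
  rw [Finset.smul_sum]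
  refine Finset.sum_congr rfl fun S hS => ?_
  rw [hcoeff, (Finset.mem_powersetCard.1 hS).2]

variable [DecidableEq ι]

/-- The complete contraction along `e`, with respect to the Euclidean metric `1`, of the `n`
Kulkarni–Nomizu products of that metric with the diagonal matrices of entries `s i`. -/
def diagContraction (e : Pattern n) : MultilinearMap R (fun _ : Fin n => ι → R) R :=
  (fullContraction e 1).compLinearMap fun _ => kulkarniNomizu 1 ∘ₗ diagonalLinearMap ι R R

theorem diagContraction_apply (e : Pattern n) (s : Fin n → ι → R) :
    diagContraction e s = fullContraction e 1 fun i => kulkarniNomizu 1 (diagonal (s i)) := rfl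

theorem map_diagContraction {R' : Type*} [CommRing R'] (f : R →+* R') (e : Pattern n)
    (s : Fin n → ι → R) : f (diagContraction e s) = diagContraction e fun i => f ∘ s i := by
  rw [diagContraction_apply, map_fullContraction, Matrix.map_one f (map_zero f) (map_one f),
    diagContraction_apply]
  congr 1
  funext i u
  simp only [Function.comp_apply, kulkarniNomizu_apply, diagonal_apply, one_apply, map_sub,
    map_add, map_mul, apply_ite f, map_zero, map_one]

theorem fullContraction_eq_diagContraction (e : Pattern n) {g E : Matrix ι ι R}
    (hE : E * Eᵀ = g) (hg : IsUnit g.det) (s : Fin n → ι → R) :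
    fullContraction e g⁻¹ (fun i => kulkarniNomizu g (E * diagonal (s i) * Eᵀ))
      = diagContraction e s := by
  have hinv : Eᵀ * g⁻¹ * E = 1 := by
    have hg' : E * (Eᵀ * g⁻¹) = 1 := by rw [← Matrix.mul_assoc, hE, mul_nonsing_inv _ hg]
    exact mul_eq_one_comm.1 hg'
  have hg₁ : E * 1 * Eᵀ = g := by rw [Matrix.mul_one, hE]
  conv_lhs =>
    enter [2, i]
    rw [← hg₁, ← changeFrame_kulkarniNomizu]
  rw [fullContraction_changeFrame, hinv, diagContraction_apply]

theorem diagContraction_comp_perm (e : Pattern n) (s : Fin n → ι → R) (σ : Equiv.Perm ι) :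
    diagContraction e (fun i => s i ∘ σ) = diagContraction e s := by
  have hσ : σ.permMatrix R * (σ.permMatrix R)ᵀ = 1 := by
    rw [transpose_permMatrix, ← permMatrix_mul, inv_mul_cancel, permMatrix_one]
  have hs : ∀ z : ι → R, σ.permMatrix R * diagonal z * (σ.permMatrix R)ᵀ = diagonal (z ∘ σ) :=
    fun z => by
      rw [transpose_permMatrix, Equiv.Perm.permMatrix, Equiv.Perm.permMatrix,
        PEquiv.toMatrix_toPEquiv_mul, PEquiv.mul_toMatrix_toPEquiv, submatrix_submatrix]
      exact submatrix_diagonal_equiv z σ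
  rw [← fullContraction_eq_diagContraction e hσ (by simp) s]
  simp only [hs, inv_one, diagContraction_apply]

theorem diagContraction_update_const_eq_zero (e : Pattern n) (c : R) (i : Fin n) {z : ι → R}
    (hz : ∑ a, z a = 0) :
    diagContraction e (Function.update (fun _ _ => c) i z) = 0 := by
  refine linearMap_eq_zero_of_perm_invariant
    (L := (diagContraction e).toLinearMap (fun _ _ => c) i) (fun σ w => ?_) hz
  rw [MultilinearMap.toLinearMap_apply, MultilinearMap.toLinearMap_apply,
    ← diagContraction_comp_perm e (Function.update (fun _ _ => c) i w) σ]
  congr 1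
  funext j
  by_cases hj : j = i <;> simp [hj]
  rfl

theorem exists_diagContraction_eq_sum (e : Pattern n) (c : R) {z : ι → R} (hz : ∑ a, z a = 0) :
    ∃ γ : ℕ → R, γ 1 = 0 ∧ ∀ X Y : R, diagContraction e (fun _ a => X * c + Y * z a)
      = ∑ j ∈ Finset.range (n + 1), γ j * (X ^ (n - j) * Y ^ j) := by
  refine ⟨fun j => ∑ S ∈ Finset.powersetCard j Finset.univ,
    diagContraction e (S.piecewise (fun _ => z) fun _ _ => c), ?_, fun X Y => ?_⟩
  · simp only [Finset.powersetCard_one, Finset.sum_map, Function.Embedding.coeFn_mk,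
      Finset.piecewise_singleton]
    exact Finset.sum_eq_zero fun i _ => diagContraction_update_const_eq_zero e c i hz
  · simp only [mul_comm _ (X ^ _ * Y ^ _)]
    exact multilinearMap_smul_add_smul (diagContraction e) X Y (fun _ => c) z

end DiagContraction

/-! ### Metrics whose curvature is diagonal in an orthonormal frame -/

section OrthonormalEigenframe

variable {ι : Type*} [Fintype ι] [DecidableEq ι]

/-- The columns of `E⁻¹ᵀ` form an orthonormal frame for `g` in which `A` is diagonal with entries
`w`. The frame is complex so that it exists for metrics `g` of every signature. -/
structure IsOrthonormalEigenframe (E : Matrix ι ι ℂ) (g A : Matrix ι ι ℝ) (w : ι → ℝ) :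
    Prop where
  mul_transpose : E * Eᵀ = g.map Complex.ofRealHom
  mul_diagonal_mul_transpose :
    E * diagonal (Complex.ofRealHom ∘ w) * Eᵀ = A.map Complex.ofRealHom

variable {E : Matrix ι ι ℂ} {g A : Matrix ι ι ℝ} {w : ι → ℝ}

theorem IsOrthonormalEigenframe.smul_add_smul (h : IsOrthonormalEigenframe E g A w) (p q : ℝ) :
    IsOrthonormalEigenframe E g (p • A + q • g) (p • w + fun _ => q) := by
  refine ⟨h.mul_transpose, ?_⟩
  have hdiag : diagonal (Complex.ofRealHom ∘ (p • w + fun _ => q))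
      = (p : ℂ) • diagonal (Complex.ofRealHom ∘ w) + (q : ℂ) • (1 : Matrix ι ι ℂ) := by
    rw [smul_one_eq_diagonal, ← diagonal_smul, diagonal_add]
    exact congrArg diagonal (funext fun a => by simp)
  rw [hdiag, Matrix.mul_add, Matrix.add_mul, Matrix.mul_smul, Matrix.mul_smul,
    Matrix.smul_mul, Matrix.smul_mul, h.mul_diagonal_mul_transpose, Matrix.mul_one,
    h.mul_transpose]
  ext a b
  simp

theorem IsOrthonormalEigenframe.isSymm (h : IsOrthonormalEigenframe E g A w) : A.IsSymm := by
  refine Matrix.map_injective Complex.ofReal_injective ?_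
  change Aᵀ.map Complex.ofRealHom = A.map Complex.ofRealHom
  rw [transpose_map, ← h.mul_diagonal_mul_transpose]
  simp only [transpose_mul, transpose_transpose, diagonal_transpose, Matrix.mul_assoc]

theorem IsOrthonormalEigenframe.isSymm_metric (h : IsOrthonormalEigenframe E g A w) :
    g.IsSymm := by
  simpa using (h.smul_add_smul 0 1).isSymm

theorem IsOrthonormalEigenframe.trace_mul_inv_pow (h : IsOrthonormalEigenframe E g A w)
    (hg : g.det ≠ 0) (m : ℕ) : ((A * g⁻¹) ^ m).trace = ∑ a, w a ^ m := by
  have hinv : g⁻¹.map Complex.ofRealHom = (E * Eᵀ)⁻¹ := by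
    refine (inv_eq_right_inv ?_).symm
    rw [h.mul_transpose, ← Matrix.map_mul, mul_nonsing_inv _ hg.isUnit,
      Matrix.map_one _ (map_zero _) (map_one _)]
  have hE : IsUnit E.det := by
    have hdet : E.det * Eᵀ.det = (g.det : ℂ) := by
      rw [← det_mul, h.mul_transpose]
      exact (RingHom.map_det _ _).symm
    exact isUnit_of_mul_isUnit_left (hdet ▸ (Complex.ofReal_ne_zero.2 hg).isUnit)
  have hconj : (A * g⁻¹).map Complex.ofRealHom
      = E * diagonal (Complex.ofRealHom ∘ w) * E⁻¹ := by
    rw [Matrix.map_mul, hinv, ← h.mul_diagonal_mul_transpose, Matrix.mul_inv_rev,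
      ← Matrix.mul_assoc, mul_nonsing_inv_cancel_right _ _ (by rwa [det_transpose])]
  apply Complex.ofReal_injective
  calc (((A * g⁻¹) ^ m).trace : ℂ) = (((A * g⁻¹).map Complex.ofRealHom) ^ m).trace := by
        rw [← Matrix.map_pow]
        exact AddMonoidHom.map_trace Complex.ofRealHom.toAddMonoidHom _
    _ = (diagonal (Complex.ofRealHom ∘ w) ^ m).trace := by
        lift E to GL ι ℂ using (isUnit_iff_isUnit_det E).2 hE
        rw [hconj, ← coe_units_inv, Units.conj_pow, trace_units_conj]
    _ = ((∑ a, w a ^ m : ℝ) : ℂ) := by simp [diagonal_pow, trace_diagonal]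

end OrthonormalEigenframe

section SchoutenSpectrum

variable {ι : Type*} [Fintype ι] [DecidableEq ι] {g : (ι → ℝ) → Matrix ι ι ℝ} {x : ι → ℝ}
  {S : Matrix ι ι ℝ} {s : ι → ℝ}

/-- The tensor `R_{abcd}` of `g` at `x`. -/
def riemannTensor (g : (ι → ℝ) → Matrix ι ι ℝ) (x : ι → ℝ) (u : Fin 4 → ι) : ℝ :=
  riemannLow g (u 0) (u 1) (u 2) (u 3) x

/-- The Riemann tensor of `g` at `x` is the Kulkarni–Nomizu product of `g` with a symmetric tensor
that is diagonal, with entries `s`, in some orthonormal frame. In dimension at least three this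
tensor is the Schouten tensor. -/
def HasSchoutenSpectrum (g : (ι → ℝ) → Matrix ι ι ℝ) (x : ι → ℝ) (s : ι → ℝ) : Prop :=
  (g x).det ≠ 0 ∧ ∃ E S, IsOrthonormalEigenframe E (g x) S s ∧
    riemannTensor g x = kulkarniNomizu (g x) S

theorem ricci_eq_sum_riemannLow (hd : (g x).det ≠ 0) (a b : ι) :
    ricci g a b x = ∑ d, ∑ f, riemannLow g a d b f x * (g x)⁻¹ f d := by
  have hraise : ∀ d, riemann g a d b d x = ((fun e => riemann g a d b e x) ᵥ* g x ᵥ* (g x)⁻¹) d :=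
    fun d => by rw [vecMul_vecMul, mul_nonsing_inv _ hd.isUnit, vecMul_one]
  simp only [ricci, hraise]
  rfl

theorem ricci_eq_of_kulkarniNomizu (hd : (g x).det ≠ 0)
    (hR : riemannTensor g x = kulkarniNomizu (g x) S) :
    (of fun a b => ricci g a b x)
      = ((Fintype.card ι : ℝ) - 2) • S + (S * (g x)⁻¹).trace • g x := by
  have hginv : g x * (g x)⁻¹ = 1 := mul_nonsing_inv _ hd.isUnit
  have hinvg : (g x)⁻¹ * g x = 1 := nonsing_inv_mul _ hd.isUnit
  ext a b
  have hlow : ∀ d f, riemannLow g a d b f x * (g x)⁻¹ f d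
      = g x a b * (S d f * (g x)⁻¹ f d) + S a b * (g x d f * (g x)⁻¹ f d)
        - g x a f * (g x)⁻¹ f d * S d b - S a f * (g x)⁻¹ f d * g x d b := fun d f => by
    have := congrFun hR ![a, d, b, f]
    simp only [riemannTensor, kulkarniNomizu_apply, cons_val] at this
    rw [this]
    ring
  have htrace : ∀ A : Matrix ι ι ℝ, ∑ d, ∑ f, A d f * (g x)⁻¹ f d = (A * (g x)⁻¹).trace :=
    fun A => rfl
  have hprod : ∀ A B : Matrix ι ι ℝ, ∑ d, ∑ f, A a f * (g x)⁻¹ f d * B d b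
      = (A * (g x)⁻¹ * B) a b := fun A B => by simp only [mul_apply, Finset.sum_mul]
  rw [of_apply, ricci_eq_sum_riemannLow hd]
  simp only [hlow, Finset.sum_sub_distrib, Finset.sum_add_distrib, ← Finset.mul_sum, htrace,
    hprod, hginv, Matrix.mul_assoc S, hinvg, Matrix.one_mul, Matrix.mul_one, trace_one,
    Matrix.add_apply, Matrix.smul_apply, smul_eq_mul]
  ring

theorem scalarCurv_eq_of_kulkarniNomizu (hg : (g x).IsSymm) (hS : S.IsSymm)
    (hd : (g x).det ≠ 0) (hR : riemannTensor g x = kulkarniNomizu (g x) S) :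
    scalarCurv g x = 2 * ((Fintype.card ι : ℝ) - 1) * (S * (g x)⁻¹).trace := by
  have htrace : scalarCurv g x = ((of fun a b => ricci g a b x)ᵀ * (g x)⁻¹).trace := by
    rw [trace_mul_comm]
    rfl
  rw [htrace, ricci_eq_of_kulkarniNomizu hd hR, transpose_add, transpose_smul, transpose_smul,
    hg.eq, hS.eq, Matrix.add_mul, smul_mul, smul_mul, mul_nonsing_inv _ hd.isUnit, trace_add,
    trace_smul, trace_smul, trace_one, smul_eq_mul, smul_eq_mul]
  ring

theorem tracelessRicci_eq_of_kulkarniNomizu [Nonempty ι] (hg : (g x).IsSymm) (hS : S.IsSymm)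
    (hd : (g x).det ≠ 0) (hR : riemannTensor g x = kulkarniNomizu (g x) S) :
    (of fun a b => tracelessRicci g a b x) = ((Fintype.card ι : ℝ) - 2) • S
      + (-((Fintype.card ι : ℝ) - 2) * ((S * (g x)⁻¹).trace / Fintype.card ι)) • g x := by
  have hι : (Fintype.card ι : ℝ) ≠ 0 := Nat.cast_ne_zero.2 Fintype.card_ne_zero
  ext a b
  have hricci := congrFun₂ (ricci_eq_of_kulkarniNomizu hd hR) a b
  simp only [of_apply, Matrix.add_apply, Matrix.smul_apply, smul_eq_mul] at hricci ⊢
  rw [tracelessRicci, scalarCurv_eq_of_kulkarniNomizu hg hS hd hR, hricci]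
  field_simp
  ring

theorem K2_eq_trace (hZ : (of fun a b => tracelessRicci g a b x).IsSymm) :
    K2 g x = 1 / ((Fintype.card ι : ℝ) * (Fintype.card ι - 1))
      * (((of fun a b => tracelessRicci g a b x) * (g x)⁻¹) ^ 2).trace := by
  set Z : Matrix ι ι ℝ := of fun a b => tracelessRicci g a b x
  have hK : K2 g x = 1 / ((Fintype.card ι : ℝ) * (Fintype.card ι - 1))
      * (Z * ((g x)⁻¹ * (Z * (g x)⁻¹))ᵀ).trace := rfl
  rw [hK, ← trace_transpose (Z * _), transpose_mul, transpose_transpose, hZ.eq, trace_mul_comm,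
    pow_two, Matrix.mul_assoc Z]

theorem K3_eq_trace :
    K3 g x = -(1 / ((Fintype.card ι : ℝ) * (Fintype.card ι - 1) * (Fintype.card ι - 2)))
      * (((of fun a b => tracelessRicci g a b x) * (g x)⁻¹) ^ 3).trace := by
  set Z : Matrix ι ι ℝ := of fun a b => tracelessRicci g a b x
  have hK : ∑ a, ∑ b, ∑ c, tracelessRicci g a b x * tracelessRicciUp g b c x
        * tracelessRicciMixed g c a x
      = (Z * ((g x)⁻¹ * (Z * (g x)⁻¹) * (Z * (g x)⁻¹))).trace := by
    conv_lhs => simp only [mul_assoc, ← Finset.mul_sum]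
    rfl
  rw [K3, hK, pow_succ, pow_two]
  simp only [Matrix.mul_assoc]

theorem HasSchoutenSpectrum.scalarCurv_eq (h : HasSchoutenSpectrum g x s) :
    scalarCurv g x = 2 * ((Fintype.card ι : ℝ) - 1) * ∑ a, s a := by
  obtain ⟨hd, E, S, hE, hR⟩ := h
  simpa only [pow_one, scalarCurv_eq_of_kulkarniNomizu hE.isSymm_metric hE.isSymm hd hR]
    using congrArg _ (hE.trace_mul_inv_pow hd 1)

theorem HasSchoutenSpectrum.exists_isOrthonormalEigenframe_tracelessRicci [Nonempty ι]
    (h : HasSchoutenSpectrum g x s) :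
    ∃ E, IsOrthonormalEigenframe E (g x) (of fun a b => tracelessRicci g a b x)
      fun a => ((Fintype.card ι : ℝ) - 2) * (s a - (∑ b, s b) / Fintype.card ι) := by
  obtain ⟨hd, E, S, hE, hR⟩ := h
  refine ⟨E, ?_⟩
  have htrace : (S * (g x)⁻¹).trace = ∑ a, s a := by simpa using hE.trace_mul_inv_pow hd 1
  rw [tracelessRicci_eq_of_kulkarniNomizu hE.isSymm_metric hE.isSymm hd hR, htrace]
  convert hE.smul_add_smul _ _ using 1
  funext a
  simp only [Pi.add_apply, Pi.smul_apply, smul_eq_mul]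
  ring

theorem HasSchoutenSpectrum.K2_eq [Nonempty ι] (h : HasSchoutenSpectrum g x s) :
    K2 g x = 1 / ((Fintype.card ι : ℝ) * (Fintype.card ι - 1))
      * ∑ a, (((Fintype.card ι : ℝ) - 2) * (s a - (∑ b, s b) / Fintype.card ι)) ^ 2 := by
  obtain ⟨E, hE⟩ := h.exists_isOrthonormalEigenframe_tracelessRicci
  rw [K2_eq_trace hE.isSymm, hE.trace_mul_inv_pow h.1]

theorem HasSchoutenSpectrum.K3_eq [Nonempty ι] (h : HasSchoutenSpectrum g x s) :
    K3 g x = -(1 / ((Fintype.card ι : ℝ) * (Fintype.card ι - 1) * (Fintype.card ι - 2)))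
      * ∑ a, (((Fintype.card ι : ℝ) - 2) * (s a - (∑ b, s b) / Fintype.card ι)) ^ 3 := by
  obtain ⟨E, hE⟩ := h.exists_isOrthonormalEigenframe_tracelessRicci
  rw [K3_eq_trace, hE.trace_mul_inv_pow h.1]

theorem HasSchoutenSpectrum.contraction_eq {n : ℕ} (e : Pattern n)
    (h : HasSchoutenSpectrum g x s) : contraction e g x = diagContraction e fun _ => s := by
  obtain ⟨hd, E, S, hE, hR⟩ := h
  have hfull : contraction e g x = fullContraction e (g x)⁻¹ fun _ => riemannTensor g x := by
    rw [fullContraction_apply]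
    rfl
  have hdet : IsUnit ((g x).map Complex.ofRealHom).det := by
    rw [← RingHom.mapMatrix_apply, ← RingHom.map_det]
    exact hd.isUnit.map _
  have hmap : Complex.ofRealHom ∘ kulkarniNomizu (g x) S
      = kulkarniNomizu ((g x).map Complex.ofRealHom) (S.map Complex.ofRealHom) := by
    funext u
    simp only [Function.comp_apply, kulkarniNomizu_apply, map_sub, map_add, map_mul, map_apply]
  have hinv : (g x)⁻¹.map Complex.ofRealHom = ((g x).map Complex.ofRealHom)⁻¹ := by
    refine (inv_eq_right_inv ?_).symm
    rw [← Matrix.map_mul, mul_nonsing_inv _ hd.isUnit,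
      Matrix.map_one _ (map_zero _) (map_one _)]
  apply Complex.ofRealHom.injective
  rw [hfull, map_fullContraction, hR, hmap, map_diagContraction, hinv,
    ← hE.mul_diagonal_mul_transpose]
  exact fullContraction_eq_diagContraction e hE.mul_transpose hdet _

theorem exists_curvInvariant_eq_sum {n : ℕ} (c : Pattern n → ℝ) (q : ℝ) {z : ι → ℝ}
    (hz : ∑ a, z a = 0) :
    ∃ γ : ℕ → ℝ, γ 1 = 0 ∧ ∀ (g : (ι → ℝ) → Matrix ι ι ℝ) (x : ι → ℝ) (X Y : ℝ),
      HasSchoutenSpectrum g x (fun a => X * q + Y * z a) →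
      curvInvariant c g x = ∑ j ∈ Finset.range (n + 1), γ j * (X ^ (n - j) * Y ^ j) := by
  choose γ hγ₁ hγ using fun e : Pattern n => exists_diagContraction_eq_sum e q hz
  refine ⟨fun j => ∑ e, c e * γ e j, by simp [hγ₁], fun g x X Y h => ?_⟩
  simp only [curvInvariant, h.contraction_eq, hγ, Finset.mul_sum, Finset.sum_mul, mul_assoc]
  exact Finset.sum_comm

end SchoutenSpectrum

/-! ### The three generating invariants -/

theorem cast_card_sub_one_ne_zero (κ : Type*) [Fintype κ] [Nontrivial κ] :
    (Fintype.card κ : ℝ) - 1 ≠ 0 :=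
  sub_ne_zero.2 (by exact_mod_cast Fintype.one_lt_card.ne')

section SplitSpectrum

open Sum

variable {κ : Type*} [Fintype κ] [DecidableEq κ] {g : (Unit ⊕ κ → ℝ) → Matrix (Unit ⊕ κ) _ ℝ}
  {x : Unit ⊕ κ → ℝ} {σ τ : ℝ}

theorem HasSchoutenSpectrum.K2_eq_of_sumElim [Nonempty κ]
    (h : HasSchoutenSpectrum g x (Sum.elim (fun _ => σ) fun _ => τ)) :
    K2 g x = (((Fintype.card κ : ℝ) - 1) * (τ - σ) / (Fintype.card κ + 1)) ^ 2 := by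
  have hκ : (Fintype.card κ : ℝ) ≠ 0 := by simp
  have hκ' : (Fintype.card κ : ℝ) + 1 ≠ 0 := by positivity
  simp only [h.K2_eq, Fintype.sum_sum_type, elim_inl, elim_inr, Finset.sum_const,
    Finset.card_univ, Fintype.card_sum, Fintype.card_unit, nsmul_eq_mul, Nat.cast_add,
    Nat.cast_one, one_mul, add_comm (1 : ℝ), add_sub_cancel_right]
  field_simp
  ring

theorem HasSchoutenSpectrum.K3_eq_of_sumElim [Nontrivial κ]
    (h : HasSchoutenSpectrum g x (Sum.elim (fun _ => σ) fun _ => τ)) :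
    K3 g x = (((Fintype.card κ : ℝ) - 1) * (τ - σ) / (Fintype.card κ + 1)) ^ 3 := by
  have hκ : (Fintype.card κ : ℝ) ≠ 0 := by simp
  have hκ₁ := cast_card_sub_one_ne_zero κ
  have hκ' : (Fintype.card κ : ℝ) + 1 ≠ 0 := by positivity
  have hD : (Fintype.card κ : ℝ) + 1 - 2 = Fintype.card κ - 1 := by ring
  simp only [h.K3_eq, Fintype.sum_sum_type, elim_inl, elim_inr, Finset.sum_const,
    Finset.card_univ, Fintype.card_sum, Fintype.card_unit, nsmul_eq_mul, Nat.cast_add,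
    Nat.cast_one, one_mul, add_comm (1 : ℝ), add_sub_cancel_right, hD]
  field_simp
  ring

theorem HasSchoutenSpectrum.scalarCurv_eq_of_sumElim
    (h : HasSchoutenSpectrum g x (Sum.elim (fun _ => σ) fun _ => τ)) :
    scalarCurv g x = 2 * Fintype.card κ * (σ + Fintype.card κ * τ) := by
  simp [h.scalarCurv_eq]

theorem exists_weighted_exponents {n j : ℕ} (hj : j ≤ n) : ∃ b₁ b₂ b₃ : ℕ,
    b₁ + 2 * b₂ + 3 * b₃ = n ∧ (j ≠ 1 → b₁ = n - j ∧ 2 * b₂ + 3 * b₃ = j) := by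
  by_cases h : j = 1
  · exact ⟨n, 0, 0, rfl, fun h' => (h' h).elim⟩
  · exact ⟨n - j, (j - 3 * (j % 2)) / 2, j % 2, by omega, fun _ => ⟨rfl, by omega⟩⟩

theorem exists_sum_eq_sum_pow_mul_pow (n : ℕ) {γ : ℕ → ℝ} (hγ : γ 1 = 0) :
    ∃ (p : ℕ) (β : Fin p → ℝ) (b₁ b₂ b₃ : Fin p → ℕ), (∀ i, b₁ i + 2 * b₂ i + 3 * b₃ i = n) ∧
      ∀ X Y : ℝ, ∑ j ∈ Finset.range (n + 1), γ j * (X ^ (n - j) * Y ^ j)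
        = ∑ i, β i * X ^ b₁ i * (Y ^ 2) ^ b₂ i * (Y ^ 3) ^ b₃ i := by
  choose b₁ b₂ b₃ hb hj using fun j : Fin (n + 1) => exists_weighted_exponents j.is_le
  refine ⟨n + 1, fun j => γ j, b₁, b₂, b₃, hb, fun X Y => ?_⟩
  rw [Finset.sum_range]
  refine Finset.sum_congr rfl fun j _ => ?_
  by_cases h : (j : ℕ) = 1
  · simp [h, hγ]
  · obtain ⟨h₁, h₂₃⟩ := hj j h
    rw [h₁, ← pow_mul, ← pow_mul, mul_assoc, mul_assoc, ← pow_add, h₂₃]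

theorem exists_curvInvariant_eq_sum_pow (κ : Type*) [Fintype κ] [DecidableEq κ] [Nontrivial κ]
    {n : ℕ} (c : Pattern n → ℝ) :
    ∃ (p : ℕ) (β : Fin p → ℝ) (b₁ b₂ b₃ : Fin p → ℕ), (∀ i, b₁ i + 2 * b₂ i + 3 * b₃ i = n) ∧
      ∀ (g : (Unit ⊕ κ → ℝ) → Matrix (Unit ⊕ κ) (Unit ⊕ κ) ℝ) (x : Unit ⊕ κ → ℝ) (σ τ : ℝ),
        HasSchoutenSpectrum g x (Sum.elim (fun _ => σ) fun _ => τ) →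
        curvInvariant c g x
          = ∑ i, β i * scalarCurv g x ^ b₁ i * K2 g x ^ b₂ i * K3 g x ^ b₃ i := by
  have hκ : (Fintype.card κ : ℝ) ≠ 0 := by simp
  have hκ₁ := cast_card_sub_one_ne_zero κ
  have hκ' : (Fintype.card κ : ℝ) + 1 ≠ 0 := by positivity
  set z : Unit ⊕ κ → ℝ := Sum.elim (fun _ => -(Fintype.card κ / (Fintype.card κ - 1)))
    fun _ => 1 / (Fintype.card κ - 1)
  have hz : ∑ a, z a = 0 := by simp [z, div_eq_mul_inv]
  obtain ⟨γ, hγ₁, hγ⟩ :=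
    exists_curvInvariant_eq_sum c (1 / (2 * Fintype.card κ * (Fintype.card κ + 1))) hz
  obtain ⟨p, β, b₁, b₂, b₃, hb, hsum⟩ := exists_sum_eq_sum_pow_mul_pow n hγ₁
  refine ⟨p, β, b₁, b₂, b₃, hb, fun g x σ τ h => ?_⟩
  rw [h.K2_eq_of_sumElim, h.K3_eq_of_sumElim, ← hsum]
  refine hγ g x _ _ ?_
  convert h using 1
  funext a
  rw [h.scalarCurv_eq_of_sumElim]
  obtain _ | i := a <;> simp only [z, elim_inl, elim_inr] <;> field_simp <;> ring

end SplitSpectrum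

/-! ### Warped products -/

theorem differentiableAt_deriv {p : ℝ → ℝ} {t : ℝ} (hp : ContDiffAt ℝ 2 p t) :
    DifferentiableAt ℝ (deriv p) t :=
  ((hp.fderiv_right (m := 1) (by norm_num)).differentiableAt (by norm_num)).clm_apply
    (differentiableAt_const _)

theorem eventually_differentiableAt {E : Type*} [NormedAddCommGroup E] [NormedSpace ℝ E]
    {f : E → ℝ} {v : E} (hf : ContDiffAt ℝ 2 f v) : ∀ᶠ w in 𝓝 v, DifferentiableAt ℝ f w :=
  (hf.eventually (by simp)).mono fun _ hw => hw.differentiableAt (by norm_num)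

section Separated

open Sum

variable {κ : Type*} [Fintype κ] [DecidableEq κ] {p : ℝ → ℝ} {q : (κ → ℝ) → ℝ}
  {x : Unit ⊕ κ → ℝ}

theorem pd_mul_comp_inr (hp : DifferentiableAt ℝ p (x (inl ())))
    (hq : DifferentiableAt ℝ q (x ∘ inr)) (a : Unit ⊕ κ) :
    pd a (fun z : Unit ⊕ κ → ℝ => p (z (inl ())) * q (z ∘ inr)) x
      = Sum.elim (fun _ => deriv p (x (inl ())) * q (x ∘ inr))
          (fun i => p (x (inl ())) * pd i q (x ∘ inr)) a := by
  have hbase : HasFDerivAt (fun z : Unit ⊕ κ → ℝ => p (z (inl ())))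
      (deriv p (x (inl ())) • ContinuousLinearMap.proj (R := ℝ) (inl ())) x :=
    hp.hasDerivAt.comp_hasFDerivAt x (hasFDerivAt_apply (inl ()) x)
  have hfibre : HasFDerivAt (fun z : Unit ⊕ κ → ℝ => q (z ∘ inr))
      (fderiv ℝ q (x ∘ inr) ∘L .pi fun i => .proj (inr i)) x :=
    hq.hasFDerivAt.comp x (hasFDerivAt_pi.2 fun i => hasFDerivAt_apply (inr i) x)
  rw [pd_mul _ hbase.differentiableAt hfibre.differentiableAt, pd, pd, hbase.fderiv,
    hfibre.fderiv, ContinuousLinearMap.comp_apply]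
  obtain ⟨⟩ | i := a
  · have hproj : (ContinuousLinearMap.pi fun i : κ => ContinuousLinearMap.proj (R := ℝ)
        (φ := fun _ : Unit ⊕ κ => ℝ) (inr i)) (Pi.single (inl ()) 1) = 0 := by
      ext i
      simp
    simp [hproj]
  · have hproj : (ContinuousLinearMap.pi fun i : κ => ContinuousLinearMap.proj (R := ℝ)
        (φ := fun _ : Unit ⊕ κ => ℝ) (inr i)) (Pi.single (inr i) 1) = Pi.single i 1 := by
      ext j
      simp [Pi.single_apply]
    simp [hproj, pd]

end Separated

section Warp

open Sum

variable {κ : Type*} {N b : ℝ → ℝ} {h : (κ → ℝ) → Matrix κ κ ℝ} {x : Unit ⊕ κ → ℝ}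

/-- The warped product metric `N(t) dt² + b(t)² h`, where `t` is the coordinate `inl ()`. -/
def warp (N b : ℝ → ℝ) (h : (κ → ℝ) → Matrix κ κ ℝ) (x : Unit ⊕ κ → ℝ) :
    Matrix (Unit ⊕ κ) (Unit ⊕ κ) ℝ :=
  fromBlocks (of fun _ _ => N (x (inl ()))) 0 0 (b (x (inl ())) ^ 2 • h (x ∘ inr))

theorem warp_isSymm (hs : (h (x ∘ inr)).IsSymm) : (warp N b h x).IsSymm :=
  isSymm_fromBlocks_iff.2 ⟨rfl, transpose_zero, transpose_zero, hs.smul _⟩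

/-- The factor depending on `t` of the Christoffel symbol `Γ_{ab,c}` of a warped product. -/
def warpBaseFactor (N b : ℝ → ℝ) : Unit ⊕ κ → Unit ⊕ κ → Unit ⊕ κ → ℝ → ℝ
  | inl _, inl _, inl _ => fun t => deriv N t / 2
  | inl _, inr _, inr _ | inr _, inl _, inr _ => fun t => b t * deriv b t
  | inr _, inr _, inl _ => fun t => -(b t * deriv b t)
  | inr _, inr _, inr _ => fun t => b t ^ 2
  | _, _, _ => 0

theorem differentiableAt_warpBaseFactor {t : ℝ} (hN : ContDiffAt ℝ 2 N t)
    (hb : ContDiffAt ℝ 2 b t) (a c d : Unit ⊕ κ) :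
    DifferentiableAt ℝ (warpBaseFactor N b a c d) t := by
  have hb₀ : DifferentiableAt ℝ b t := hb.differentiableAt (by norm_num)
  have hN' : DifferentiableAt ℝ (deriv N) t := differentiableAt_deriv hN
  have hb' : DifferentiableAt ℝ (deriv b) t := differentiableAt_deriv hb
  obtain _ | i := a <;> obtain _ | j := c <;> obtain _ | k := d <;>
    simp only [warpBaseFactor] <;> fun_prop

variable [Fintype κ]

theorem contDiffAt_warp (hN : ContDiffAt ℝ 2 N (x (inl ()))) (hb : ContDiffAt ℝ 2 b (x (inl ())))
    (hh : ∀ i j, ContDiffAt ℝ 2 (fun y => h y i j) (x ∘ inr)) (a c : Unit ⊕ κ) :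
    ContDiffAt ℝ 2 (fun z => warp N b h z a c) x := by
  have hbase : ContDiffAt ℝ 2 (fun z : Unit ⊕ κ → ℝ => z (inl ())) x :=
    (contDiff_apply ℝ ℝ _).contDiffAt
  have hfibre : ContDiffAt ℝ 2 (fun z : Unit ⊕ κ → ℝ => z ∘ inr) x :=
    contDiffAt_pi.2 fun i => (contDiff_apply ℝ ℝ _).contDiffAt
  obtain _ | i := a <;> obtain _ | j := c
  · exact hN.comp x hbase
  · exact contDiffAt_const
  · exact contDiffAt_const
  · exact ((hb.comp x hbase).pow 2).mul (ContDiffAt.comp (g := fun y => h y i j) x (hh i j) hfibre)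

variable [DecidableEq κ]

theorem det_warp (N b : ℝ → ℝ) (h : (κ → ℝ) → Matrix κ κ ℝ) (x : Unit ⊕ κ → ℝ) :
    (warp N b h x).det
      = N (x (inl ())) * ((b (x (inl ())) ^ 2) ^ Fintype.card κ * (h (x ∘ inr)).det) := by
  rw [warp, det_fromBlocks_zero₂₁, det_smul, det_unique, of_apply]

theorem det_warp_ne_zero (hN : N (x (inl ())) ≠ 0) (hb : b (x (inl ())) ≠ 0)
    (hd : (h (x ∘ inr)).det ≠ 0) : (warp N b h x).det ≠ 0 := by
  rw [det_warp]
  positivity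

theorem inv_warp (hN : N (x (inl ())) ≠ 0) (hb : b (x (inl ())) ≠ 0)
    (hd : (h (x ∘ inr)).det ≠ 0) :
    (warp N b h x)⁻¹ = fromBlocks (of fun _ _ => (N (x (inl ())))⁻¹) 0 0
      ((b (x (inl ())) ^ 2)⁻¹ • (h (x ∘ inr))⁻¹) := by
  have hbase : (of fun _ _ => N (x (inl ())) : Matrix Unit Unit ℝ)
      * of (fun _ _ => (N (x (inl ())))⁻¹) = 1 := by
    ext
    simp [Matrix.mul_apply, hN]
  refine inv_eq_right_inv ?_
  have hfibre : (b (x (inl ())) ^ 2 • h (x ∘ inr)) * ((b (x (inl ())) ^ 2)⁻¹ • (h (x ∘ inr))⁻¹)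
      = 1 := by
    rw [Matrix.smul_mul, Matrix.mul_smul, smul_smul, mul_nonsing_inv _ hd.isUnit,
      mul_inv_cancel₀ (pow_ne_zero 2 hb), one_smul]
  rw [warp, fromBlocks_multiply, hbase, hfibre]
  simp only [Matrix.zero_mul, Matrix.mul_zero, add_zero, zero_add, fromBlocks_one]

/-- The factor depending on the point of the fibre of the Christoffel symbol `Γ_{ab,c}` of a warped
product. -/
def warpFibreFactor (h : (κ → ℝ) → Matrix κ κ ℝ) :
    Unit ⊕ κ → Unit ⊕ κ → Unit ⊕ κ → (κ → ℝ) → ℝ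
  | inl _, inr i, inr j | inr i, inl _, inr j | inr i, inr j, inl _ => fun y => h y i j
  | inr i, inr j, inr k => christoffelLow h i j k
  | _, _, _ => 1

theorem christoffelLow_warp (hN : DifferentiableAt ℝ N (x (inl ())))
    (hb : DifferentiableAt ℝ b (x (inl ())))
    (hh : ∀ i j, DifferentiableAt ℝ (fun y => h y i j) (x ∘ inr)) (a c d : Unit ⊕ κ) :
    christoffelLow (warp N b h) a c d x
      = warpBaseFactor N b a c d (x (inl ())) * warpFibreFactor h a c d (x ∘ inr) := by
  have hbb : deriv (fun t => b t ^ 2) (x (inl ())) = 2 * b (x (inl ())) * deriv b (x (inl ())) := by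
    simpa using (hb.hasDerivAt.fun_pow 2).deriv
  have htt : ∀ e, pd e (fun z => warp N b h z (inl ()) (inl ())) x
      = Sum.elim (fun _ => deriv N (x (inl ()))) 0 e := fun e => by
    have := pd_mul_comp_inr (q := fun _ : κ → ℝ => 1) hN (differentiableAt_const _) e
    simp only [mul_one, pd_const, mul_zero] at this
    exact this
  have hti : ∀ e i, pd e (fun z => warp N b h z (inl ()) (inr i)) x = 0 :=
    fun e _ => pd_const e (0 : ℝ)
  have hit : ∀ e i, pd e (fun z => warp N b h z (inr i) (inl ())) x = 0 :=
    fun e _ => pd_const e (0 : ℝ)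
  have hij : ∀ e i j, pd e (fun z => warp N b h z (inr i) (inr j)) x
      = Sum.elim (fun _ => 2 * b (x (inl ())) * deriv b (x (inl ())) * h (x ∘ inr) i j)
          (fun k => b (x (inl ())) ^ 2 * pd k (fun y => h y i j) (x ∘ inr)) e := fun e i j => by
    rw [← hbb]
    exact pd_mul_comp_inr (p := fun t => b t ^ 2) (hb.pow 2) (hh i j) e
  obtain _ | i := a <;> obtain _ | j := c <;> obtain _ | k := d <;>
    simp only [christoffelLow, htt, hti, hit, hij, warpBaseFactor, warpFibreFactor, elim_inl,
      elim_inr, Pi.zero_apply, Pi.one_apply] <;>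
    ring

theorem differentiableAt_warpFibreFactor {y : κ → ℝ}
    (hh : ∀ i j, ContDiffAt ℝ 2 (fun y => h y i j) y) (a c d : Unit ⊕ κ) :
    DifferentiableAt ℝ (warpFibreFactor h a c d) y := by
  have hh₀ := fun i j => (hh i j).differentiableAt (by norm_num)
  obtain _ | i := a <;> obtain _ | j := c <;> obtain _ | k := d
  all_goals first
    | exact hh₀ _ _
    | exact differentiableAt_christoffelLow hh _ _ _
    | exact differentiableAt_const _

theorem pd_christoffelLow_warp (hN : ContDiffAt ℝ 2 N (x (inl ())))
    (hb : ContDiffAt ℝ 2 b (x (inl ())))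
    (hh : ∀ i j, ContDiffAt ℝ 2 (fun y => h y i j) (x ∘ inr)) (e a c d : Unit ⊕ κ) :
    pd e (christoffelLow (warp N b h) a c d) x = Sum.elim
      (fun _ => deriv (warpBaseFactor N b a c d) (x (inl ())) * warpFibreFactor h a c d (x ∘ inr))
      (fun i => warpBaseFactor N b a c d (x (inl ())) * pd i (warpFibreFactor h a c d) (x ∘ inr))
      e := by
  have hbase : Tendsto (fun z : Unit ⊕ κ → ℝ => z (inl ())) (𝓝 x) (𝓝 (x (inl ()))) :=
    (continuous_apply _).tendsto x
  have hfibre : Tendsto (fun z : Unit ⊕ κ → ℝ => z ∘ inr) (𝓝 x) (𝓝 (x ∘ inr)) :=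
    (continuous_pi fun i => continuous_apply (inr i)).tendsto x
  have heq : christoffelLow (warp N b h) a c d =ᶠ[𝓝 x] fun z =>
      warpBaseFactor N b a c d (z (inl ())) * warpFibreFactor h a c d (z ∘ inr) := by
    filter_upwards [hbase.eventually (eventually_differentiableAt hN),
      hbase.eventually (eventually_differentiableAt hb), hfibre.eventually (eventually_all.2
        fun i => eventually_all.2 fun j => eventually_differentiableAt (hh i j))]
      with z hNz hbz hhz
    exact christoffelLow_warp hNz hbz hhz a c d
  rw [pd_congr _ heq]
  exact pd_mul_comp_inr (differentiableAt_warpBaseFactor hN hb a c d)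
    (differentiableAt_warpFibreFactor hh a c d) e

theorem christoffelInner_warp (hN : N (x (inl ())) ≠ 0) (hb : b (x (inl ())) ≠ 0)
    (hd : (h (x ∘ inr)).det ≠ 0) (a c d e : Unit ⊕ κ) :
    christoffelInner (warp N b h) a c d e x
      = (N (x (inl ())))⁻¹ * christoffelLow (warp N b h) a c (inl ()) x
          * christoffelLow (warp N b h) d e (inl ()) x
        + (b (x (inl ())) ^ 2)⁻¹ * ((fun i => christoffelLow (warp N b h) a c (inr i) x) ⬝ᵥ
          (h (x ∘ inr))⁻¹ *ᵥ fun i => christoffelLow (warp N b h) d e (inr i) x) := by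
  rw [christoffelInner, inv_warp hN hb hd]
  simp [dotProduct, mulVec, Finset.mul_sum, mul_assoc, mul_left_comm]

end Warp

theorem row_dotProduct_inv_mulVec {κ : Type*} [Fintype κ] [DecidableEq κ] {g : Matrix κ κ ℝ}
    (hd : g.det ≠ 0) (i : κ) (v : κ → ℝ) : g i ⬝ᵥ g⁻¹ *ᵥ v = v i :=
  calc g i ⬝ᵥ g⁻¹ *ᵥ v = (g *ᵥ g⁻¹ *ᵥ v) i := rfl
    _ = v i := by rw [mulVec_mulVec, mul_nonsing_inv _ hd.isUnit, one_mulVec]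

theorem dotProduct_inv_mulVec_row {κ : Type*} [Fintype κ] [DecidableEq κ] {g : Matrix κ κ ℝ}
    (hs : g.IsSymm) (hd : g.det ≠ 0) (i : κ) (v : κ → ℝ) : v ⬝ᵥ g⁻¹ *ᵥ g i = v i := by
  rw [dotProduct_mulVec, dotProduct_comm, ← mulVec_transpose, transpose_nonsing_inv, hs.eq,
    row_dotProduct_inv_mulVec hd]

theorem mul_dotProduct_mulVec_mul {κ : Type*} [Fintype κ] (A : Matrix κ κ ℝ) (p q : ℝ)
    (v w : κ → ℝ) : (fun i => p * v i) ⬝ᵥ A *ᵥ (fun i => q * w i) = p * q * (v ⬝ᵥ A *ᵥ w) := by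
  rw [show (fun i => p * v i) = p • v from rfl, show (fun i => q * w i) = q • w from rfl,
    mulVec_smul, dotProduct_smul, smul_dotProduct, smul_eq_mul, smul_eq_mul, mul_left_comm,
    mul_assoc]

/-- The sectional curvature of `N(t) dt² + b(t)² h` in the planes that contain `∂_t`. -/
def warpRadialCurvature (N b : ℝ → ℝ) (t : ℝ) : ℝ :=
  -(deriv (deriv b) t - deriv b t * deriv N t / (2 * N t)) / (N t * b t)

/-- The sectional curvature of `N(t) dt² + b(t)² h` in the planes tangent to the fibres, where `h`
has constant sectional curvature `K`. -/
def warpFibreCurvature (K : ℝ) (N b : ℝ → ℝ) (t : ℝ) : ℝ :=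
  (K - deriv b t ^ 2 / N t) / b t ^ 2

section WarpCurvature

open Sum

variable {κ : Type*} [Fintype κ] [DecidableEq κ] {N b : ℝ → ℝ} {h : (κ → ℝ) → Matrix κ κ ℝ}
  {x : Unit ⊕ κ → ℝ} (hs : ∀ y, (h y).IsSymm) (hN : ContDiffAt ℝ 2 N (x (inl ())))
  (hb : ContDiffAt ℝ 2 b (x (inl ())))
  (hh : ∀ i j, ContDiffAt ℝ 2 (fun y => h y i j) (x ∘ inr)) (hN₀ : N (x (inl ())) ≠ 0)
  (hb₀ : b (x (inl ())) ≠ 0) (hd : (h (x ∘ inr)).det ≠ 0)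

include hs hN hb hh hN₀ hb₀ hd

theorem riemannLow_warp (a c d e : Unit ⊕ κ) : riemannLow (warp N b h) a c d e x
    = -pd a (christoffelLow (warp N b h) c d e) x + pd c (christoffelLow (warp N b h) a d e) x
      + christoffelInner (warp N b h) a e c d x - christoffelInner (warp N b h) c e a d x :=
  riemannLow_eq_christoffelLow (fun _ => warp_isSymm (hs _)) (contDiffAt_warp hN hb hh)
    (det_warp_ne_zero hN₀ hb₀ hd) a c d e

theorem riemannLow_warp_inl_inr_inl_inr (i j : κ) :
    riemannLow (warp N b h) (inl ()) (inr i) (inl ()) (inr j) x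
      = warpRadialCurvature N b (x (inl ()))
        * (N (x (inl ())) * (b (x (inl ())) ^ 2 * h (x ∘ inr) i j)) := by
  have hb₁ := hb.differentiableAt (by norm_num)
  rw [riemannLow_warp hs hN hb hh hN₀ hb₀ hd]
  simp only [pd_christoffelLow_warp hN hb hh, christoffelInner_warp hN₀ hb₀ hd,
    christoffelLow_warp (hN.differentiableAt (by norm_num)) hb₁
      fun i j => (hh i j).differentiableAt (by norm_num), warpBaseFactor, warpFibreFactor,
    mul_dotProduct_mulVec_mul, row_dotProduct_inv_mulVec hd, elim_inl, elim_inr,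
    deriv_fun_mul hb₁ (differentiableAt_deriv hb), Pi.zero_apply, Pi.one_apply,
    warpRadialCurvature]
  field_simp
  ring

theorem riemannLow_warp_inl_inr_inr_inr (i j k : κ) :
    riemannLow (warp N b h) (inl ()) (inr i) (inr j) (inr k) x = 0 := by
  have hb₁ := hb.differentiableAt (by norm_num)
  rw [riemannLow_warp hs hN hb hh hN₀ hb₀ hd]
  simp only [pd_christoffelLow_warp hN hb hh, christoffelInner_warp hN₀ hb₀ hd,
    christoffelLow_warp (hN.differentiableAt (by norm_num)) hb₁
      fun i j => (hh i j).differentiableAt (by norm_num), warpBaseFactor, warpFibreFactor,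
    mul_dotProduct_mulVec_mul, row_dotProduct_inv_mulVec hd, dotProduct_inv_mulVec_row (hs _) hd,
    elim_inl, elim_inr, pd_metric hs, deriv_fun_pow hb₁, Nat.cast_ofNat, Pi.zero_apply]
  field_simp
  ring

theorem riemannLow_warp_inr_inr_inl_inr (i j k : κ) :
    riemannLow (warp N b h) (inr i) (inr j) (inl ()) (inr k) x = 0 := by
  have hb₁ := hb.differentiableAt (by norm_num)
  rw [riemannLow_warp hs hN hb hh hN₀ hb₀ hd]
  simp only [pd_christoffelLow_warp hN hb hh, christoffelInner_warp hN₀ hb₀ hd,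
    christoffelLow_warp (hN.differentiableAt (by norm_num)) hb₁
      fun i j => (hh i j).differentiableAt (by norm_num), warpBaseFactor, warpFibreFactor,
    mul_dotProduct_mulVec_mul, dotProduct_inv_mulVec_row (hs _) hd,
    elim_inr, pd_metric hs, christoffelLow_symm hs j i, Pi.zero_apply]
  field_simp
  ring

theorem riemannLow_warp_inr_inr_inr_inr (i j k l : κ) :
    riemannLow (warp N b h) (inr i) (inr j) (inr k) (inr l) x
      = b (x (inl ())) ^ 2 * riemannLow h i j k l (x ∘ inr)
        - (b (x (inl ())) * deriv b (x (inl ()))) ^ 2 / N (x (inl ()))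
          * (h (x ∘ inr) i k * h (x ∘ inr) j l - h (x ∘ inr) i l * h (x ∘ inr) j k) := by
  have hb₁ := hb.differentiableAt (by norm_num)
  rw [riemannLow_warp hs hN hb hh hN₀ hb₀ hd]
  simp only [pd_christoffelLow_warp hN hb hh, christoffelInner_warp hN₀ hb₀ hd,
    christoffelLow_warp (hN.differentiableAt (by norm_num)) hb₁
      fun i j => (hh i j).differentiableAt (by norm_num), warpBaseFactor, warpFibreFactor,
    mul_dotProduct_mulVec_mul, elim_inr]
  rw [riemannLow_eq_christoffelLow hs hh hd, christoffelInner, christoffelInner]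
  field_simp
  ring

end WarpCurvature

section WarpSpectrum

open Sum

variable {κ : Type*}

theorem eq_zero_of_antisymm_pairs {T : Unit ⊕ κ → Unit ⊕ κ → Unit ⊕ κ → Unit ⊕ κ → ℝ}
    (hl : ∀ a b c d, T b a c d = -T a b c d) (hr : ∀ a b c d, T a b d c = -T a b c d)
    (h₁ : ∀ i j, T (inl ()) (inr i) (inl ()) (inr j) = 0)
    (h₂ : ∀ i j k, T (inl ()) (inr i) (inr j) (inr k) = 0)
    (h₃ : ∀ i j k, T (inr i) (inr j) (inl ()) (inr k) = 0)
    (h₄ : ∀ i j k l, T (inr i) (inr j) (inr k) (inr l) = 0) : T = 0 := by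
  have hl₀ : ∀ a c d, T a a c d = 0 := fun a c d => self_eq_neg.1 (hl a a c d)
  have hr₀ : ∀ a b c, T a b c c = 0 := fun a b c => self_eq_neg.1 (hr a b c c)
  funext a b c d
  obtain ⟨⟩ | i := a <;> obtain ⟨⟩ | j := b <;> obtain ⟨⟩ | k := c <;> obtain ⟨⟩ | l := d <;>
    simp only [hl₀, hr₀, h₁, h₂, h₃, h₄, hl (inl ()) (inr _), hr _ _ (inl ()) (inr _), neg_zero,
      Pi.zero_apply]

variable {ι : Type*} [Fintype ι] [DecidableEq ι]

theorem IsOrthonormalEigenframe.unique {E : Matrix ι ι ℂ} {g A A' : Matrix ι ι ℝ} {w : ι → ℝ}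
    (h : IsOrthonormalEigenframe E g A w) (h' : IsOrthonormalEigenframe E g A' w) : A = A' :=
  Matrix.map_injective Complex.ofRealHom.injective
    (h.mul_diagonal_mul_transpose.symm.trans h'.mul_diagonal_mul_transpose)

theorem HasSchoutenSpectrum.riemannLow_eq_of_const {g : (ι → ℝ) → Matrix ι ι ℝ} {x : ι → ℝ}
    {s : ℝ} (h : HasSchoutenSpectrum g x fun _ => s) (a b c d : ι) :
    riemannLow g a b c d x = 2 * s * (g x a c * g x b d - g x a d * g x b c) := by
  obtain ⟨-, E, S, hE, hR⟩ := h
  have hscalar : S = s • g x := by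
    refine hE.unique ?_
    simpa only [zero_smul, zero_add] using hE.smul_add_smul 0 s
  have := congrFun hR ![a, b, c, d]
  rw [hscalar, kulkarniNomizu_apply] at this
  simp only [riemannTensor, cons_val, Matrix.smul_apply, smul_eq_mul] at this
  rw [this]
  ring

variable [Fintype κ] [DecidableEq κ] {N b : ℝ → ℝ} {h : (κ → ℝ) → Matrix κ κ ℝ}
  {x : Unit ⊕ κ → ℝ}

theorem exists_isOrthonormalEigenframe_warp {E : Matrix κ κ ℂ}
    (hE : E * Eᵀ = (h (x ∘ inr)).map Complex.ofRealHom) (r s : ℝ) :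
    ∃ E', IsOrthonormalEigenframe E' (warp N b h x)
      (fromBlocks (of fun _ _ => r * N (x (inl ()))) 0 0 ((s * b (x (inl ())) ^ 2) • h (x ∘ inr)))
      (Sum.elim (fun _ => r) fun _ => s) := by
  obtain ⟨ν, hν⟩ := IsAlgClosed.exists_pow_nat_eq (N (x (inl ())) : ℂ) two_pos
  set E' := fromBlocks (of fun _ _ : Unit => ν) 0 0 ((b (x (inl ())) : ℂ) • E)
  have hdiag : ∀ p q : ℝ, E' * diagonal (Complex.ofRealHom ∘ Sum.elim (fun _ => p) fun _ => q) * E'ᵀ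
      = (fromBlocks (of fun _ _ => p * N (x (inl ()))) 0 0
        ((q * b (x (inl ())) ^ 2) • h (x ∘ inr))).map Complex.ofRealHom := fun p q => by
    have hsplit : diagonal (Complex.ofRealHom ∘ Sum.elim (fun _ : Unit => p) fun _ : κ => q)
        = fromBlocks ((p : ℂ) • 1) 0 0 ((q : ℂ) • 1) := by
      rw [smul_one_eq_diagonal, smul_one_eq_diagonal, fromBlocks_diagonal, Sum.comp_elim]
      rfl
    have hfibre : (q * b (x (inl ())) ^ 2 : ℂ) • (E * Eᵀ)
        = ((q * b (x (inl ())) ^ 2) • h (x ∘ inr)).map Complex.ofRealHom := by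
      rw [hE]
      ext
      simp
    rw [hsplit, fromBlocks_transpose, fromBlocks_multiply, fromBlocks_multiply, fromBlocks_map,
      ← hfibre]
    congr 1
    · ext
      simp [Matrix.mul_apply, ← hν, mul_comm, pow_two, mul_left_comm]
    · simp
    · simp
    · simp only [transpose_smul, transpose_zero, Matrix.mul_smul, Matrix.smul_mul, smul_smul,
        Matrix.mul_zero, zero_add, Matrix.mul_one]
      congr 1
      ring
  refine ⟨E', ?_, hdiag r s⟩
  have hone : (Sum.elim (fun _ : Unit => (1 : ℝ)) fun _ : κ => 1) = fun _ => 1 :=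
    Sum.elim_const_const _
  simpa [hone, Function.comp_def, warp] using hdiag 1 1

theorem riemannTensor_warp {K : ℝ} (hs : ∀ y, (h y).IsSymm)
    (hN : ContDiffAt ℝ 2 N (x (inl ()))) (hb : ContDiffAt ℝ 2 b (x (inl ())))
    (hh : ∀ i j, ContDiffAt ℝ 2 (fun y => h y i j) (x ∘ inr)) (hN₀ : N (x (inl ())) ≠ 0)
    (hb₀ : b (x (inl ())) ≠ 0) (hd : (h (x ∘ inr)).det ≠ 0)
    (hK : ∀ i j k l, riemannLow h i j k l (x ∘ inr)
      = K * (h (x ∘ inr) i k * h (x ∘ inr) j l - h (x ∘ inr) i l * h (x ∘ inr) j k)) :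
    riemannTensor (warp N b h) x = kulkarniNomizu (warp N b h x) (fromBlocks
      (of fun _ _ => (warpRadialCurvature N b (x (inl ()))
        - warpFibreCurvature K N b (x (inl ())) / 2) * N (x (inl ()))) 0 0
      ((warpFibreCurvature K N b (x (inl ())) / 2 * b (x (inl ())) ^ 2) • h (x ∘ inr))) := by
  set S : Matrix (Unit ⊕ κ) (Unit ⊕ κ) ℝ := fromBlocks _ _ _ _
  suffices hzero : (fun p q r s => riemannLow (warp N b h) p q r s x
      - kulkarniNomizu (warp N b h x) S ![p, q, r, s]) = 0 by
    funext u
    have hu := congrFun (congrFun (congrFun (congrFun hzero (u 0)) (u 1)) (u 2)) (u 3)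
    simpa only [riemannTensor, kulkarniNomizu_apply, cons_val, Pi.zero_apply, sub_eq_zero] using hu
  apply eq_zero_of_antisymm_pairs
  · intro p q r s
    rw [riemannLow_swap_left, kulkarniNomizu_apply, kulkarniNomizu_apply]
    simp only [cons_val]
    ring
  · intro p q r s
    rw [riemannLow_swap_right (fun _ => warp_isSymm (hs _)) (contDiffAt_warp hN hb hh)
      (det_warp_ne_zero hN₀ hb₀ hd), kulkarniNomizu_apply, kulkarniNomizu_apply]
    simp only [cons_val]
    ring
  · intro i j
    simp only [riemannLow_warp_inl_inr_inl_inr hs hN hb hh hN₀ hb₀ hd, kulkarniNomizu_apply, warp,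
      S, cons_val, fromBlocks_apply₁₁, fromBlocks_apply₁₂, fromBlocks_apply₂₁, fromBlocks_apply₂₂,
      of_apply, Matrix.smul_apply, smul_eq_mul, Matrix.zero_apply, mul_zero, sub_zero]
    ring
  · intro i j k
    simp [S, riemannLow_warp_inl_inr_inr_inr hs hN hb hh hN₀ hb₀ hd, kulkarniNomizu_apply, warp]
  · intro i j k
    simp [S, riemannLow_warp_inr_inr_inl_inr hs hN hb hh hN₀ hb₀ hd, kulkarniNomizu_apply, warp]
  · intro i j k l
    simp only [riemannLow_warp_inr_inr_inr_inr hs hN hb hh hN₀ hb₀ hd, hK, kulkarniNomizu_apply,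
      warp, warpFibreCurvature, S, cons_val, fromBlocks_apply₂₂, Matrix.smul_apply, smul_eq_mul]
    field_simp
    ring

theorem hasSchoutenSpectrum_warp {K : ℝ} (hs : ∀ y, (h y).IsSymm)
    (hN : ContDiffAt ℝ 2 N (x (inl ()))) (hb : ContDiffAt ℝ 2 b (x (inl ())))
    (hh : ∀ i j, ContDiffAt ℝ 2 (fun y => h y i j) (x ∘ inr)) (hN₀ : N (x (inl ())) ≠ 0)
    (hb₀ : b (x (inl ())) ≠ 0) (hK : HasSchoutenSpectrum h (x ∘ inr) fun _ => K / 2) :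
    HasSchoutenSpectrum (warp N b h) x (Sum.elim
      (fun _ => warpRadialCurvature N b (x (inl ())) - warpFibreCurvature K N b (x (inl ())) / 2)
      (fun _ => warpFibreCurvature K N b (x (inl ())) / 2)) := by
  have hconst := hK.riemannLow_eq_of_const
  rw [mul_div_cancel₀ K two_ne_zero] at hconst
  obtain ⟨hd, E, A, hE, -⟩ := hK
  obtain ⟨E', hE'⟩ := exists_isOrthonormalEigenframe_warp (N := N) (b := b) hE.mul_transpose
    (warpRadialCurvature N b (x (inl ())) - warpFibreCurvature K N b (x (inl ())) / 2)
    (warpFibreCurvature K N b (x (inl ())) / 2)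
  exact ⟨det_warp_ne_zero hN₀ hb₀ hd, E', _, hE',
    riemannTensor_warp hs hN hb hh hN₀ hb₀ hd hconst⟩

end WarpSpectrum

/-! ### FLRW metrics -/

theorem exists_mul_transpose_eq_of_posSemidef {ι : Type*} [Fintype ι] {A : Matrix ι ι ℝ}
    (hA : A.PosSemidef) : ∃ E : Matrix ι ι ℝ, E * Eᵀ = A := by
  classical
  open scoped MatrixOrder in
  obtain ⟨E, hE⟩ := CStarAlgebra.nonneg_iff_eq_mul_star_self.1 hA.nonneg
  exact ⟨E, by rw [hE, star_eq_conjTranspose, conjTranspose_eq_transpose_of_trivial]⟩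

theorem hasSchoutenSpectrum_const_of_posDef {ι : Type*} [Fintype ι] [DecidableEq ι]
    {g : (ι → ℝ) → Matrix ι ι ℝ} {x : ι → ℝ} {s : ℝ} (hg : (g x).PosDef)
    (hR : ∀ a b c d,
      riemannLow g a b c d x = 2 * s * (g x a c * g x b d - g x a d * g x b c)) :
    HasSchoutenSpectrum g x fun _ => s := by
  obtain ⟨E, hE⟩ := exists_mul_transpose_eq_of_posSemidef hg.posSemidef
  have hframe : IsOrthonormalEigenframe (E.map Complex.ofRealHom) (g x) (g x) fun _ => 1 := by
    rw [← hE]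
    exact ⟨by simp [transpose_map], by simp [transpose_map, Function.comp_def]⟩
  refine ⟨hg.det_pos.ne', E.map Complex.ofRealHom, s • g x, ?_, ?_⟩
  · simpa only [zero_smul, zero_add] using hframe.smul_add_smul 0 s
  · funext u
    rw [riemannTensor, hR, kulkarniNomizu_apply]
    simp only [Matrix.smul_apply, smul_eq_mul]
    ring

section FLRW

open Sum

variable {m : ℕ} {ψ : (Fin m → ℝ) → EuclideanSpace ℝ (Fin (m + 1))} {U : Set (Fin m → ℝ)}

/-- The metric `dr² / (1 - k r²) + r² dΩ_m²` of the spatial slices `a = 1`. -/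
def spaceMetric (k : ℝ) (ψ : (Fin m → ℝ) → EuclideanSpace ℝ (Fin (m + 1))) :
    (Unit ⊕ Fin m → ℝ) → Matrix (Unit ⊕ Fin m) (Unit ⊕ Fin m) ℝ :=
  warp (fun r => 1 / (1 - k * r ^ 2)) id (roundMetric ψ)

theorem flrwMetric_eq_warp (k : ℝ) (a F : ℝ → ℝ)
    (ψ : (Fin m → ℝ) → EuclideanSpace ℝ (Fin (m + 1))) :
    flrwMetric k a F ψ = warp (fun t => -F t) a (spaceMetric k ψ) := by
  funext x
  have hang : angOf x = (x ∘ inr) ∘ inr := rfl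
  ext p q
  obtain ⟨⟩ | ⟨⟩ | i := p <;> obtain ⟨⟩ | ⟨⟩ | j := q <;>
    simp [flrwMetric, warp, spaceMetric, tOf, rOf, hang, div_eq_mul_inv, mul_assoc]

theorem IsSphereParam.contDiffAt_roundMetric {y : Fin m → ℝ} (h : IsSphereParam ψ U) (hy : y ∈ U)
    (i j : Fin m) : ContDiffAt ℝ 2 (fun z => roundMetric ψ z i j) y :=
  contDiffAt_inducedMetric (h.contDiffAt hy 3) i j

theorem IsSphereParam.hasSchoutenSpectrum_roundMetric {y : Fin m → ℝ} (h : IsSphereParam ψ U)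
    (hy : y ∈ U) : HasSchoutenSpectrum (roundMetric ψ) y fun _ => 1 / 2 := by
  refine hasSchoutenSpectrum_const_of_posDef (h.posDef_roundMetric hy) fun a b c d => ?_
  rw [h.riemannLow_roundMetric hy]
  ring

theorem contDiffAt_one_div_one_sub {k r : ℝ} (hk : 1 - k * r ^ 2 ≠ 0) :
    ContDiffAt ℝ 2 (fun r => 1 / (1 - k * r ^ 2)) r := by
  fun_prop (disch := exact hk)

theorem deriv_one_div_one_sub {k r : ℝ} (hk : 1 - k * r ^ 2 ≠ 0) :
    deriv (fun r => 1 / (1 - k * r ^ 2)) r = 2 * k * r / (1 - k * r ^ 2) ^ 2 := by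
  have hpoly : HasDerivAt (fun r => 1 - k * r ^ 2) (-(k * (2 * r))) r := by
    simpa using ((hasDerivAt_pow 2 r).const_mul k).const_sub 1
  simp only [one_div, (hpoly.fun_inv hk).deriv]
  ring

theorem warpRadialCurvature_space {k r : ℝ} (hr : r ≠ 0) (hk : 1 - k * r ^ 2 ≠ 0) :
    warpRadialCurvature (fun r => 1 / (1 - k * r ^ 2)) id r = k := by
  rw [warpRadialCurvature, deriv_one_div_one_sub hk, deriv_id', deriv_const, id]
  field_simp
  ring

theorem warpFibreCurvature_space {k r : ℝ} (hr : r ≠ 0) :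
    warpFibreCurvature 1 (fun r => 1 / (1 - k * r ^ 2)) id r = k := by
  rw [warpFibreCurvature, deriv_id', id]
  field_simp
  ring

theorem IsSphereParam.hasSchoutenSpectrum_spaceMetric {k : ℝ} {y : Unit ⊕ Fin m → ℝ}
    (h : IsSphereParam ψ U) (hr : y (inl ()) ≠ 0) (hk : 1 - k * y (inl ()) ^ 2 ≠ 0)
    (hU : y ∘ inr ∈ U) : HasSchoutenSpectrum (spaceMetric k ψ) y fun _ => k / 2 := by
  have hspec := hasSchoutenSpectrum_warp (b := id) (inducedMetric_isSymm ψ)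
    (contDiffAt_one_div_one_sub hk) contDiffAt_id (h.contDiffAt_roundMetric hU)
    (one_div_ne_zero hk) hr (h.hasSchoutenSpectrum_roundMetric hU)
  rw [warpRadialCurvature_space hr hk, warpFibreCurvature_space hr, sub_half] at hspec
  rwa [show (fun _ : Unit ⊕ Fin m => k / 2) = Sum.elim (fun _ => k / 2) fun _ => k / 2 from
    (Sum.elim_const_const _).symm]

theorem IsSphereParam.hasSchoutenSpectrum_flrwMetric {k : ℝ} {a F : ℝ → ℝ} {x : Idx m → ℝ}
    (h : IsSphereParam ψ U) (ha : ContDiffAt ℝ 2 a (tOf x)) (hF : ContDiffAt ℝ 2 F (tOf x))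
    (ha₀ : a (tOf x) ≠ 0) (hF₀ : F (tOf x) ≠ 0) (hr : rOf x ≠ 0) (hk : 1 - k * rOf x ^ 2 ≠ 0)
    (hU : angOf x ∈ U) :
    HasSchoutenSpectrum (flrwMetric k a F ψ) x (Sum.elim
      (fun _ => warpRadialCurvature (fun t => -F t) a (tOf x)
        - warpFibreCurvature k (fun t => -F t) a (tOf x) / 2)
      (fun _ => warpFibreCurvature k (fun t => -F t) a (tOf x) / 2)) := by
  rw [flrwMetric_eq_warp]
  exact hasSchoutenSpectrum_warp (fun _ => warp_isSymm (inducedMetric_isSymm ψ _)) hF.neg ha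
    (contDiffAt_warp (contDiffAt_one_div_one_sub hk) contDiffAt_id (h.contDiffAt_roundMetric hU))
    (neg_ne_zero.2 hF₀) ha₀ (h.hasSchoutenSpectrum_spaceMetric hr hk hU)

theorem flrwGamma_eq (D : ℕ) (k : ℝ) {a F : ℝ → ℝ} {t : ℝ} (ha₀ : a t ≠ 0) (hF₀ : F t ≠ 0) :
    flrwGamma D k a F t = ((D : ℝ) - 2) / D *
      (warpFibreCurvature k (fun t => -F t) a t - warpRadialCurvature (fun t => -F t) a t) := by
  rw [flrwGamma, warpFibreCurvature, warpRadialCurvature, deriv.fun_neg]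
  field_simp
  ring

end FLRW

end Curv

end

theorem mainTheorem5_general (D : ℕ) (hD : 3 ≤ D) (n : ℕ) (c : Curv.Pattern n → ℝ) :
    ∃ (p : ℕ) (β : Fin p → ℝ) (b₁ b₂ b₃ : Fin p → ℕ),
      (∀ i, b₁ i + 2 * b₂ i + 3 * b₃ i = n) ∧
      ∀ (k : ℝ) (a F : ℝ → ℝ) (U : Set (Fin (D - 2) → ℝ))
        (ψ : (Fin (D - 2) → ℝ) → EuclideanSpace ℝ (Fin (D - 2 + 1))),
        Curv.IsSphereParam ψ U →
      ∀ x : Curv.Idx (D - 2) → ℝ,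
        ContDiffAt ℝ 2 a (Curv.tOf x) → ContDiffAt ℝ 2 F (Curv.tOf x) →
        a (Curv.tOf x) ≠ 0 → F (Curv.tOf x) ≠ 0 → Curv.rOf x ≠ 0 →
        1 - k * Curv.rOf x ^ 2 ≠ 0 → Curv.angOf x ∈ U →
        Curv.curvInvariant c (Curv.flrwMetric k a F ψ) x
            = ∑ i, β i * Curv.scalarCurv (Curv.flrwMetric k a F ψ) x ^ b₁ i
                * Curv.K2 (Curv.flrwMetric k a F ψ) x ^ b₂ i
                * Curv.K3 (Curv.flrwMetric k a F ψ) x ^ b₃ i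
          ∧ Curv.K2 (Curv.flrwMetric k a F ψ) x = Curv.flrwGamma D k a F (Curv.tOf x) ^ 2
          ∧ Curv.K3 (Curv.flrwMetric k a F ψ) x = Curv.flrwGamma D k a F (Curv.tOf x) ^ 3 := by
  have hcard : Fintype.card (Unit ⊕ Fin (D - 2)) = D - 1 := by
    rw [Fintype.card_sum, Fintype.card_unit, Fintype.card_fin]
    omega
  have : Nontrivial (Unit ⊕ Fin (D - 2)) := Fintype.one_lt_card_iff_nontrivial.1 (by omega)
  obtain ⟨p, β, b₁, b₂, b₃, hb, hsum⟩ := Curv.exists_curvInvariant_eq_sum_pow (Unit ⊕ Fin (D - 2)) c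
  refine ⟨p, β, b₁, b₂, b₃, hb, fun k a F U ψ hψ x ha hF ha₀ hF₀ hr hk hU => ?_⟩
  have hspec := hψ.hasSchoutenSpectrum_flrwMetric ha hF ha₀ hF₀ hr hk hU
  refine ⟨hsum _ _ _ _ hspec, ?_, ?_⟩
  · rw [hspec.K2_eq_of_sumElim, Curv.flrwGamma_eq D k ha₀ hF₀, hcard, Nat.cast_pred (by omega)]
    ring
  · rw [hspec.K3_eq_of_sumElim, Curv.flrwGamma_eq D k ha₀ hF₀, hcard, Nat.cast_pred (by omega)]
    ring

/-- In dimension `D ≥ 3`, every linear combination of curvature invariants of order `n` is, on all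
FLRW metrics, one and the same linear combination of products `R^b₁ K₂^b₂ K₃^b₃` with
`b₁ + 2 b₂ + 3 b₃ = n`; moreover `K₂ = Γ²` and `K₃ = Γ³` there. -/
theorem mainTheorem5 (D : ℕ) (hD : 3 ≤ D) (n : ℕ) (c : Curv.Pattern n → ℝ) :
    ∃ (p : ℕ) (β : Fin p → ℝ) (b₁ b₂ b₃ : Fin p → ℕ),
      (∀ i, b₁ i + 2 * b₂ i + 3 * b₃ i = n) ∧
      ∀ (k : ℝ), (k = -1 ∨ k = 0 ∨ k = 1) →
      ∀ (I : Set ℝ) (a F : ℝ → ℝ), IsOpen I →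
        ContDiffOn ℝ 2 a I → ContDiffOn ℝ 2 F I →
        (∀ t ∈ I, 0 < a t) → (∀ t ∈ I, 0 < F t) →
      ∀ (U : Set (Fin (D - 2) → ℝ))
        (ψ : (Fin (D - 2) → ℝ) → EuclideanSpace ℝ (Fin (D - 2 + 1))),
        Curv.IsSphereParam ψ U →
      ∀ x : Curv.Idx (D - 2) → ℝ,
        Curv.tOf x ∈ I → 0 < Curv.rOf x → 0 < 1 - k * Curv.rOf x ^ 2 → Curv.angOf x ∈ U →
        Curv.curvInvariant c (Curv.flrwMetric k a F ψ) x
            = ∑ i, β i * Curv.scalarCurv (Curv.flrwMetric k a F ψ) x ^ b₁ i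
                * Curv.K2 (Curv.flrwMetric k a F ψ) x ^ b₂ i
                * Curv.K3 (Curv.flrwMetric k a F ψ) x ^ b₃ i
          ∧ Curv.K2 (Curv.flrwMetric k a F ψ) x = Curv.flrwGamma D k a F (Curv.tOf x) ^ 2
          ∧ Curv.K3 (Curv.flrwMetric k a F ψ) x = Curv.flrwGamma D k a F (Curv.tOf x) ^ 3 := by
  obtain ⟨p, β, b₁, b₂, b₃, hb, h⟩ := mainTheorem5_general D hD n c
  exact ⟨p, β, b₁, b₂, b₃, hb, fun k _ I a F hI ha hF ha₀ hF₀ U ψ hψ x ht hr hk hU =>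
    h k a F U ψ hψ x (ha.contDiffAt (hI.mem_nhds ht)) (hF.contDiffAt (hI.mem_nhds ht))
      (ha₀ _ ht).ne' (hF₀ _ ht).ne' hr.ne' hk.ne' hU⟩
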